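/- **Setting.** Let $\mathcal N$ be a finite nonempty set of $N$ agents and $\Theta$ a finite set of $M$ parameters with true parameter $\theta^*\in\Theta$. Agent $i$ has a convex compact strategy set $\mathcal X_i\subset\mathbb R^{d_i}$; $\mathcal X=\prod_i\mathcal X_i$. Its cost is $u_i:\mathcal X\times\Theta\to\mathbb R$, and its realized cost at $(x,\theta)$ is $u_i(x,\theta)$ plus a zero-mean noise and has the probability density $f_i(\cdot\,|x,\theta)$ with respect to a fixed $\sigma$-finite measure on $\mathbb R$ (e.g. Lebesgue measure). For $m\in\Delta(\Theta)$ put $u_i(x,m)=\sum_\theta m(\theta)u_i(x,\theta)$ and $\mathrm{BR}_i(x_{-i},m)=\arg\min_{x_i\in\mathcal X_i}u_i(x_i,x_{-i},m)$. A Nash equilibrium under the common belief $m$ is a profile $x^*(m)\in\mathcal X$ with $x_i^*(m)\in \mathrm{BR}_i(x_{-i}^*(m),m)$ for all $i$. **Algorithm.** Let $W=[w_{ij}]$ be a weight matrix and $(\alpha^{(t)})_{t\ge0}$ a non-increasing step-size sequence. Start from $x^{(0)}\in\mathcal X$ and $\mu_i^{(0)}$ uniform on $\Theta$. At time $t$,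 conditionally on $x^{(0)},\dots,x^{(t)}$ and $y^{(0)},\dots,y^{(t-1)}$, the realized costs $(y_j^{(t)})_{j}$ have the distribution $\prod_j f_j(\cdot\,|x^{(t)},\theta^*)$, and $$b_i^{(t)}(\theta)=\frac{f_i(y_i^{(t)}|x^{(t)},\theta)^{\alpha^{(t)}}\mu_i^{(t)}(\theta)}{\sum_{\theta'}f_i(y_i^{(t)}|x^{(t)},\theta')^{\alpha^{(t)}}\mu_i^{(t)}(\theta')},\qquad \mu_i^{(t+1)}(\theta)=\frac{\exp\big(\sum_jw_{ij}\log b_j^{(t)}(\theta)\big)}{\sum_{\theta'}\exp\big(\sum_jw_{ij}\log b_j^{(t)}(\theta')\big)},$$ $$x_i^{(t+1)}\in(1-\alpha^{(t)})x_i^{(t)}+\alpha^{(t)}\mathrm{BR}_i\big(x_{-i}^{(t)},\mu_i^{(t+1)}\big).$$ **Assumptions.** 1. There is $L>0$ with $\big|\log\frac{f_i(y|x,\theta')}{f_i(y|x,\theta'')}\big|\le L$ for all $i,y,\theta',\theta''$ and $x\in\mathcal X$ (where one of the likelihoods $f_i(y|x,\cdot)$ vanishes, all do, and nothing is required), and $x\mapsto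 f_i(y|x,\theta)$ is continuous on $\mathcal X$. 2. For every $\theta\ne\theta^*$ there is an agent $i$ with $D_{KL}(f_i(\cdot|x,\theta^*)\|f_i(\cdot|x,\theta))>0$ for all $x\in\mathcal X$. 3. The undirected communication graph on $\mathcal N$ (loops allowed) is connected, $W$ is doubly stochastic, and $w_{ij}>0$ if and only if $(j,i)$ is an edge. 4. $0<\alpha^{(t)}<1$, $\sum_t\alpha^{(t)}=\infty$, $\sum_t(\alpha^{(t)})^2<\infty$. 5. $u_i(\cdot,\theta)$ is continuous on $\mathcal X$ and strictly convex in $x_i$, for all $i,\theta$. 6. Almost surely, if $\mu$ is the common limit of the belief sequences $(\mu_i^{(t)})_t$, then there is a Nash equilibrium $x^*(\mu)$ under $\mu$ such that every solution $\bar x:[0,\infty)\to\mathcal X$ of $\dot{\bar x}_i(t)\in\mathrm{BR}_i(\bar x_{-i}(t),\mu)-\bar x_i(t)$ $(i\in\mathcal N)$, from any initial profile in $\mathcal X$, converges to $x^*(\mu)$ as $t\to\infty$. **Theorem 3.** Under Assumptions 1–6, almost surely all belief sequences $(\mu_i^{(t)})_t$ converge to a common belief $\mu\in\Delta(\Theta)$,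 there is exactly one Nash equilibrium $x^*(\mu)$ under $\mu$, and, with the (finite) network divergence $$Z(\theta^*,\theta_k)=\frac1N\sum_{j}D_{KL}\big(f_j(\cdot|x^*(\mu),\theta^*)\,\|\,f_j(\cdot|x^*(\mu),\theta_k)\big)$$ and $s^{(T)}=\sum_{t=1}^T\alpha^{(t)}$, the following hold for every agent $i$: - for every $\theta_k\in\Theta$, $\displaystyle\lim_{T\to\infty}\frac1{s^{(T)}}\log\frac{\mu_i^{(T+1)}(\theta^*)}{\mu_i^{(T+1)}(\theta_k)}=Z(\theta^*,\theta_k)$; - $Z(\theta^*,\theta_k)>0$ for every $\theta_k\neq\theta^*$; - $\mu_i^{(t)}(\theta^*)\to1$ as $t\to\infty$; - for every $\epsilon>0$ there is a (random) $T'$ such that for all $T\ge T'$, $$\frac1{1+\sum_{\theta_k\ne\theta^*}\exp\big(-s^{(T)}(Z(\theta^*,\theta_k)-\epsilon)\big)}\le\mu_i^{(T+1)}(\theta^*)\le1 .$$ -/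

import Mathlib

open MeasureTheory ProbabilityTheory Filter Topology

noncomputable section

namespace LearningGame

/-- Strategy profiles `x = col{x₁, …, x_N}`, agent `i` choosing a vector of `ℝ^(d i)`. -/
abbrev Profile {ι : Type*} (d : ι → ℕ) : Type _ :=
  (i : ι) → EuclideanSpace ℝ (Fin (d i))

/-- The data of a stage game with an unknown parameter in `Θ`: strategy sets, costs, and the
likelihoods `f i y x θ` of the realized costs, as densities with respect to a reference measure
`ref i` on `ℝ` (the Lebesgue measure, say). -/
structure Game (ι Θ : Type*) (d : ι → ℕ) where
  strat : (i : ι) → Set (EuclideanSpace ℝ (Fin (d i)))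
  cost : ι → Profile d → Θ → ℝ
  ref : ι → Measure ℝ
  f : ι → ℝ → Profile d → Θ → ℝ

variable {ι Θ Ω : Type*} {d : ι → ℕ}

namespace Game

/-- The set of strategy profiles `𝒳 = ∏ i, 𝒳 i`. -/
def profiles (G : Game ι Θ d) : Set (Profile d) :=
  {x | ∀ i, x i ∈ G.strat i}

/-- The distribution of the realized cost of agent `i` at the profile `x` and parameter `θ`. -/
def law (G : Game ι Θ d) (i : ι) (x : Profile d) (θ : Θ) : Measure ℝ :=
  (G.ref i).withDensity fun y => ENNReal.ofReal (G.f i y x θ)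

/-- The standing conventions on the stage game: strategy sets are convex and compact, the
likelihoods are probability densities, and the realized cost is the cost plus a noise of zero
mean, that is, its distribution has mean `cost i x θ`. -/
structure IsModel (G : Game ι Θ d) : Prop where
  convex_strat : ∀ i, Convex ℝ (G.strat i)
  compact_strat : ∀ i, IsCompact (G.strat i)
  sigmaFinite_ref : ∀ i, SigmaFinite (G.ref i)
  f_nonneg : ∀ i y, ∀ x ∈ G.profiles, ∀ θ, 0 ≤ G.f i y x θ
  f_measurable : ∀ i, ∀ x ∈ G.profiles, ∀ θ, Measurable fun y => G.f i y x θ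
  law_prob : ∀ i, ∀ x ∈ G.profiles, ∀ θ, IsProbabilityMeasure (G.law i x θ)
  noise_integrable : ∀ i, ∀ x ∈ G.profiles, ∀ θ, Integrable (fun y => y) (G.law i x θ)
  noise_mean : ∀ i, ∀ x ∈ G.profiles, ∀ θ, ∫ y, y ∂(G.law i x θ) = G.cost i x θ

/-- Bounded information content and continuity of the likelihoods. The first clause says that
the likelihood ratios are meaningful: if one of the likelihoods of a signal vanishes then so do
all the others (and then the ratio `0 / 0` imposes no bound). -/
structure BoundedInformation (G : Game ι Θ d) : Prop where
  common_support : ∀ i y, ∀ x ∈ G.profiles, ∀ θ' θ'', G.f i y x θ'' = 0 → G.f i y x θ' = 0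
  bounded : ∃ L : ℝ, 0 < L ∧ ∀ i, ∀ θ' θ'', ∀ x ∈ G.profiles, ∀ y,
    |Real.log (G.f i y x θ' / G.f i y x θ'')| ≤ L
  continuous : ∀ i y θ, ContinuousOn (fun x => G.f i y x θ) G.profiles

/-- Global identifiability of the true parameter. -/
def Identifiable (G : Game ι Θ d) (θs : Θ) : Prop :=
  ∀ θ, θ ≠ θs → ∃ i, ∀ x ∈ G.profiles,
    0 < InformationTheory.klDiv (G.law i x θs) (G.law i x θ)

/-- Costs are continuous in the profile and strictly convex in the own strategy. -/
structure ConvexCosts [DecidableEq ι] (G : Game ι Θ d) : Prop where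
  continuous : ∀ i θ, ContinuousOn (fun x => G.cost i x θ) G.profiles
  strictConvex : ∀ i θ, ∀ x ∈ G.profiles,
    StrictConvexOn ℝ (G.strat i) fun z => G.cost i (Function.update x i z) θ

/-- Expected cost under a belief `m` on the parameter. -/
def expCost [Fintype Θ] (G : Game ι Θ d) (i : ι) (x : Profile d) (m : Θ → ℝ) : ℝ :=
  ∑ θ, m θ * G.cost i x θ

/-- The best responses of agent `i` to the strategies `x_{-i}` of the others under the belief
`m`; the coordinate `x i` plays no role. -/
def bestResponse [Fintype Θ] [DecidableEq ι] (G : Game ι Θ d) (i : ι) (x : Profile d)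
    (m : Θ → ℝ) : Set (EuclideanSpace ℝ (Fin (d i))) :=
  {z | z ∈ G.strat i ∧ ∀ z' ∈ G.strat i,
    G.expCost i (Function.update x i z) m ≤ G.expCost i (Function.update x i z') m}

/-- Nash equilibria of the game with the common belief `m`. -/
def IsNash [Fintype Θ] [DecidableEq ι] (G : Game ι Θ d) (m : Θ → ℝ) (x : Profile d) : Prop :=
  x ∈ G.profiles ∧ ∀ i, ∀ z ∈ G.strat i,
    G.expCost i x m ≤ G.expCost i (Function.update x i z) m

/-- `xbar`, on `[0, ∞)`, is a solution in the set of profiles of the best-response dynamics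
`d xbar_i / dt ∈ BR_i(xbar_{-i}(t), m) - xbar_i(t)`. -/
def IsBRSolution [Fintype Θ] [DecidableEq ι] (G : Game ι Θ d) (m : Θ → ℝ)
    (xbar : ℝ → Profile d) : Prop :=
  ∀ t, 0 ≤ t → xbar t ∈ G.profiles ∧ ∀ i, ∃ z ∈ G.bestResponse i (xbar t) m,
    HasDerivWithinAt (fun s => xbar s i) (z - xbar t i) (Set.Ici 0) t

/-- Every solution of the best-response dynamics under the common belief `m`, from any initial
profile, converges to the Nash equilibrium of the game with the common belief `m`. -/
def BRConverges [Fintype Θ] [DecidableEq ι] (G : Game ι Θ d) (m : Θ → ℝ) : Prop :=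
  ∃ xs, G.IsNash m xs ∧ ∀ xbar, G.IsBRSolution m xbar → Tendsto xbar atTop (𝓝 xs)

/-- The network divergence `Z(θ*, θ)` at the profile `x`. -/
def networkDivergence [Fintype ι] (G : Game ι Θ d) (x : Profile d) (θs θ : Θ) : ENNReal :=
  (∑ j, InformationTheory.klDiv (G.law j x θs) (G.law j x θ)) / (Fintype.card ι : ENNReal)

end Game

/-- A connected undirected communication graph with edge relation `E` (loops are allowed) and a
doubly stochastic weight matrix `W` supported on its edges. -/
structure IsNetwork [Fintype ι] [DecidableEq ι] (E : ι → ι → Prop) (W : Matrix ι ι ℝ) :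
    Prop where
  symm : ∀ i j, E i j → E j i
  connected : ∀ i j, Relation.ReflTransGen E i j
  doublyStochastic : W ∈ doublyStochastic ℝ ι
  pos_iff : ∀ i j, 0 < W i j ↔ E j i

/-- Step sizes: non-increasing, in `(0, 1)`, not summable, square summable. -/
structure IsStepSize (α : ℕ → ℝ) : Prop where
  antitone : Antitone α
  mem_Ioo : ∀ t, α t ∈ Set.Ioo (0 : ℝ) 1
  sum_eq_top : Tendsto (fun T => ∑ t ∈ Finset.range T, α t) atTop atTop
  sq_summable : Summable fun t => α t ^ 2

/-- Tempered Bayesian update, with exponent `a`, of a belief `m` by the likelihoods `ℓ`. -/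
def posterior [Fintype Θ] (a : ℝ) (ℓ m : Θ → ℝ) (θ : Θ) : ℝ :=
  ℓ θ ^ a * m θ / ∑ θ', ℓ θ' ^ a * m θ'

/-- Geometric averaging of the posteriors `b j` with weights `w j`. -/
def pool [Fintype ι] [Fintype Θ] (w : ι → ℝ) (b : ι → Θ → ℝ) (θ : Θ) : ℝ :=
  Real.exp (∑ j, w j * Real.log (b j θ)) / ∑ θ', Real.exp (∑ j, w j * Real.log (b j θ'))

/-- The beliefs `belief t i θ = μ_i^(t)(θ)` computed by the algorithm along a trajectory `x` of
profiles and `y` of realized costs. -/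
def belief [Fintype ι] [Fintype Θ] (G : Game ι Θ d) (W : Matrix ι ι ℝ) (α : ℕ → ℝ)
    (x : ℕ → Profile d) (y : ℕ → ι → ℝ) : ℕ → ι → Θ → ℝ
  | 0 => fun _ _ => 1 / (Fintype.card Θ : ℝ)
  | t + 1 => fun i =>
      pool (W i) fun j =>
        posterior (α t) (fun θ => G.f j (y t j) (x t) θ) (belief G W α x y t j)

/-- The past at the time when the costs of period `t` are realized: the profiles of the periods
`0, …, t` and the realized costs of the periods `0, …, t - 1`. -/
@[reducible]
def history (x : ℕ → Ω → Profile d) (y : ℕ → Ω → ι → ℝ) (t : ℕ) : MeasurableSpace Ω :=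
  (⨆ s ∈ Set.Iic t, MeasurableSpace.comap (x s) inferInstance) ⊔
    ⨆ s ∈ Set.Iio t, MeasurableSpace.comap (y s) inferInstance

/-- The random profiles `x t` and realized costs `y t` are generated by the learning algorithm
when the true parameter is `θs`. -/
structure IsRun [Fintype ι] [DecidableEq ι] [Fintype Θ] [MeasurableSpace Ω] (P : Measure Ω)
    (G : Game ι Θ d) (W : Matrix ι ι ℝ) (α : ℕ → ℝ) (θs : Θ)
    (x : ℕ → Ω → Profile d) (y : ℕ → Ω → ι → ℝ) : Prop where
  measurable_x : ∀ t, Measurable (x t)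
  measurable_y : ∀ t, Measurable (y t)
  init_mem : ∀ ω, x 0 ω ∈ G.profiles
  /-- Given the past, the realized costs have the distribution `∏ j, f j (· | x t, θs)`. -/
  cond_law : ∀ (t : ℕ) (B : ι → Set ℝ), (∀ i, MeasurableSet (B i)) →
    P[Set.indicator {ω | ∀ i, y t ω i ∈ B i} (fun _ => (1 : ℝ)) | history x y t]
      =ᵐ[P] fun ω => ∏ i, (G.law i (x t ω) θs).real (B i)
  /-- The best-response update of the strategies with the updated private beliefs. -/
  strategy_update : ∀ (ω : Ω) (t : ℕ) (i : ι),
    ∃ z ∈ G.bestResponse i (x t ω)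
        (belief G W α (fun s => x s ω) (fun s => y s ω) (t + 1) i),
      x (t + 1) ω i = (1 - α t) • x t ω i + α t • z

end LearningGame

end

open LearningGame

/-! In a ratio of beliefs the normalisers cancel, so log-odds of `θs` against `θ` obey a linear
recursion: add `α t` times the fresh log-likelihood ratios, then apply `W`
(`log_belief_div_belief`). Given the past, these ratios have the divergences `info` as means, so the
log-odds split into a drift and a martingale noise.

The noise stays bounded almost surely (`IsRun.ae_bounded_noise`), since `W` contracts the Euclidean
norm and the squared steps are summable. The drift spreads evenly over the agents. As `W` may be
periodic, its powers need not converge; but profiles move by O(`α t`), so the drift varies slowly,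
and summation by parts against a Poisson equation replaces mixing
(`IsNetwork.tendsto_diffuse_sub_average`). Hence every agent's log-odds equal the accumulated
network average of `info`, up to o(elapsed time).

By compactness and identifiability that average is bounded below by a positive constant over all
profiles, so beliefs concentrate on `θs` however the strategies behave. Only then does the
attraction hypothesis enter, at the point mass. There best responses are unique and depend
continuously on profile and belief, so the profiles discretise the best-response dynamics. The
attractor is not assumed stable, and convergence of the profiles is not claimed; attraction still
suffices for step-weighted time averages of continuous functions (`tendsto_time_average`). Applied
to the averaged `info`, this gives the rate. -/

noncomputable section

namespace LearningGame

/-! ### Averaging over the network and the Poisson equation. -/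

variable {ι : Type*} [Fintype ι]

/-- Accumulation of the signals `r t`, weighted by `α t` and averaged over the network. -/
def diffuse (W : Matrix ι ι ℝ) (α : ℕ → ℝ) (r : ℕ → ι → ℝ) : ℕ → ι → ℝ
  | 0 => 0
  | t + 1 => W.mulVec (diffuse W α r t + α t • r t)

theorem diffuse_add (W : Matrix ι ι ℝ) (α : ℕ → ℝ) (r r' : ℕ → ι → ℝ) (t : ℕ) :
    diffuse W α (r + r') t = diffuse W α r t + diffuse W α r' t := by
  induction t with
  | zero => simp [diffuse]
  | succ t ih =>
    simp only [diffuse, ih, Pi.add_apply, smul_add, ← Matrix.mulVec_add]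
    congr 1; abel

/-- The average of the coordinates of a vector. -/
def average (v : ι → ℝ) : ℝ := (∑ i, v i) / Fintype.card ι

theorem average_add (v w : ι → ℝ) : average (v + w) = average v + average w := by
  simp [average, Finset.sum_add_distrib, add_div]

theorem average_smul (c : ℝ) (v : ι → ℝ) : average (c • v) = c * average v := by
  simp [average, ← Finset.mul_sum, mul_div_assoc]

theorem average_const [Nonempty ι] (c : ℝ) : average (fun _ : ι => c) = c := by
  simp [average]

variable [DecidableEq ι]

theorem average_mulVec {W : Matrix ι ι ℝ} (hW : W ∈ doublyStochastic ℝ ι) (v : ι → ℝ) :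
    average (W.mulVec v) = average v := by
  have h := (mem_doublyStochastic_iff_sum.1 hW).2.2
  unfold average
  congr 1
  simp only [Matrix.mulVec, dotProduct]
  rw [Finset.sum_comm]
  simp [← Finset.sum_mul, h]

theorem mulVec_const {W : Matrix ι ι ℝ} (hW : W ∈ doublyStochastic ℝ ι) (c : ℝ) :
    W.mulVec (fun _ => c) = fun _ => c := by
  have h := (mem_doublyStochastic_iff_sum.1 hW).2.1
  ext i
  simp [Matrix.mulVec, dotProduct, ← Finset.sum_mul, h]

theorem norm_mulVec_le {W : Matrix ι ι ℝ} (hW : W ∈ doublyStochastic ℝ ι) (v : ι → ℝ) :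
    ‖W.mulVec v‖ ≤ ‖v‖ := by
  obtain ⟨h0, h1, -⟩ := mem_doublyStochastic_iff_sum.1 hW
  refine (pi_norm_le_iff_of_nonneg (norm_nonneg _)).2 fun i => ?_
  calc ‖W.mulVec v i‖ ≤ ∑ j, ‖W i j * v j‖ := norm_sum_le _ _
    _ ≤ ∑ j, W i j * ‖v‖ := by
        refine Finset.sum_le_sum fun j _ => ?_
        rw [norm_mul, Real.norm_of_nonneg (h0 i j)]
        exact mul_le_mul_of_nonneg_left (norm_le_pi_norm v j) (h0 i j)
    _ = ‖v‖ := by rw [← Finset.sum_mul, h1, one_mul]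

/-- Jensen's inequality in each row, then unit column sums. The noise estimate needs this quadratic
norm, in which martingale increments are orthogonal. -/
theorem sum_sq_mulVec_le {W : Matrix ι ι ℝ} (hW : W ∈ doublyStochastic ℝ ι) (v : ι → ℝ) :
    ∑ i, W.mulVec v i ^ 2 ≤ ∑ i, v i ^ 2 := by
  obtain ⟨h0, h1, h2⟩ := mem_doublyStochastic_iff_sum.1 hW
  calc ∑ i, W.mulVec v i ^ 2 ≤ ∑ i, ∑ j, W i j * v j ^ 2 := by
        refine Finset.sum_le_sum fun i _ => ?_
        have := (even_two.convexOn_pow (𝕜 := ℝ)).map_sum_le (t := Finset.univ) (w := W i) (p := v)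
          (fun j _ => h0 i j) (h1 i) (fun _ _ => Set.mem_univ _)
        simpa [Matrix.mulVec, dotProduct] using this
    _ = ∑ i, v i ^ 2 := by
        rw [Finset.sum_comm]
        simp [← Finset.sum_mul, h2]

theorem average_diffuse {W : Matrix ι ι ℝ} (hW : W ∈ doublyStochastic ℝ ι) (α : ℕ → ℝ)
    (r : ℕ → ι → ℝ) (T : ℕ) :
    average (diffuse W α r T) = ∑ t ∈ Finset.range T, α t * average (r t) := by
  induction T with
  | zero => simp [diffuse, average]
  | succ t ih =>
    rw [diffuse, average_mulVec hW, average_add, average_smul, ih, Finset.sum_range_succ]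

/-- Harmonic functions of an irreducible network are constant. -/
theorem IsNetwork.eq_of_mulVec_eq {E : ι → ι → Prop} {W : Matrix ι ι ℝ} (h : IsNetwork E W)
    {v : ι → ℝ} (hv : W.mulVec v = v) (i j : ι) : v i = v j := by
  obtain ⟨h0, h1, -⟩ := mem_doublyStochastic_iff_sum.1 h.doublyStochastic
  have : Nonempty ι := ⟨i⟩
  obtain ⟨m, hm⟩ := Finite.exists_max v
  -- Maximum principle: where the maximum is attained, the weighted gaps to it sum to zero, so every
  -- neighbour attains it too.
  have step : ∀ a b, v a = v m → E a b → v b = v m := by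
    intro a b ha hab
    have hw : 0 < W a b := (h.pos_iff a b).2 (h.symm _ _ hab)
    have hsum : ∑ c, W a c * (v m - v c) = 0 := by
      have : ∑ c, W a c * v c = v a := congrFun hv a
      simp only [mul_sub, Finset.sum_sub_distrib, ← Finset.sum_mul, h1, this, ha]
      ring
    have := (Finset.sum_eq_zero_iff_of_nonneg
      (fun c _ => mul_nonneg (h0 a c) (sub_nonneg.2 (hm c)))).1 hsum b (Finset.mem_univ _)
    rcases mul_eq_zero.1 this with h' | h'
    · exact absurd h' hw.ne'
    · linarith
  have all : ∀ b, v b = v m := by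
    intro b
    induction h.connected m b with
    | refl => rfl
    | tail _ hab ih => exact step _ _ ih hab
  rw [all i, all j]

/-- The Poisson equation of an irreducible network can be solved linearly. -/
theorem IsNetwork.exists_poisson [Nonempty ι] {E : ι → ι → Prop} {W : Matrix ι ι ℝ}
    (h : IsNetwork E W) :
    ∃ B : (ι → ℝ) →ₗ[ℝ] (ι → ℝ), ∀ g, B g - W.mulVec (B g) = g - fun _ => average g := by
  -- Adding the average to `1 - W` removes the constants from the kernel. `A` preserves averages, so
  -- its inverse solves the Poisson equation.
  let A : (ι → ℝ) →ₗ[ℝ] (ι → ℝ) :=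
    { toFun := fun v => v - W.mulVec v + fun _ => average v
      map_add' := fun v w => by
        rw [average_add, Matrix.mulVec_add]; ext; simp; ring
      map_smul' := fun c v => by
        rw [average_smul, Matrix.mulVec_smul]; ext; simp; ring }
  have hA : ∀ v, A v = v - W.mulVec v + fun _ => average v := fun v => rfl
  have havg : ∀ v, average (A v) = average v := by
    intro v
    have : A v = v + (-1 : ℝ) • W.mulVec v + fun _ => average v := by rw [hA]; ext; simp; ring
    rw [this, average_add, average_add, average_smul, average_mulVec h.doublyStochastic,
      average_const]
    ring
  have hinj : Function.Injective A := by
    rw [← LinearMap.ker_eq_bot, LinearMap.ker_eq_bot']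
    intro v hv
    have h0 : average v = 0 := by rw [← havg, hv]; simp [average]
    have h1 : W.mulVec v = v := by
      have := hA v
      rw [hv, h0] at this
      ext i
      have := congrFun this i
      simp at this
      linarith
    have hc := h.eq_of_mulVec_eq h1
    ext i
    have : v = fun _ => v i := by ext j; exact hc j i
    rw [this, average_const] at h0
    simpa using h0
  let e := LinearEquiv.ofInjectiveEndo A hinj
  refine ⟨e.symm.toLinearMap, fun g => ?_⟩
  have he : A (e.symm g) = g := e.apply_symm_apply g
  have h2 := havg (e.symm g)
  rw [he] at h2
  have h3 := hA (e.symm g)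
  rw [he, ← h2] at h3
  simp only [LinearEquiv.coe_coe]
  nth_rewrite 3 [h3]
  ext; simp

/-- Weighted Cesàro means: errors that are o(`α t`) sum to o of the divergent sum. -/
theorem tendsto_weighted_average {α b : ℕ → ℝ} {l : ℝ} (hα : ∀ t, 0 ≤ α t)
    (hs : Tendsto (fun T => ∑ t ∈ Finset.range T, α t) atTop atTop)
    (hb : Tendsto b atTop (𝓝 l)) :
    Tendsto (fun T => (∑ t ∈ Finset.range T, α t * b t) / ∑ t ∈ Finset.range T, α t)
      atTop (𝓝 l) := by
  have h0 : (fun t => α t * (b t - l)) =o[atTop] α := by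
    have : (fun t => b t - l) =o[atTop] fun _ => (1 : ℝ) := by
      rw [Asymptotics.isLittleO_one_iff]
      simpa using hb.sub_const l
    simpa using (Asymptotics.isBigO_refl α atTop).mul_isLittleO this
  have h1 := (h0.sum_range hα hs).tendsto_div_nhds_zero
  have h2 := h1.add_const l
  rw [zero_add] at h2
  refine h2.congr' ?_
  filter_upwards [hs.eventually_gt_atTop 0] with T hT
  simp only [mul_sub, Finset.sum_sub_distrib, ← Finset.sum_mul]
  field_simp
  ring

/-- Slowly varying signals spread evenly over an irreducible network, even a periodic one. -/
theorem IsNetwork.tendsto_diffuse_sub_average [Nonempty ι] {E : ι → ι → Prop}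
    {W : Matrix ι ι ℝ} (h : IsNetwork E W) {α : ℕ → ℝ} (hα : IsStepSize α) {g : ℕ → ι → ℝ}
    {C : ℝ} (hC : ∀ t, ‖g t‖ ≤ C) (hg : Tendsto (fun t => g (t + 1) - g t) atTop (𝓝 0)) (i : ι) :
    Tendsto (fun T => (diffuse W α g T i - average (diffuse W α g T)) /
      ∑ t ∈ Finset.range T, α t) atTop (𝓝 0) := by
  obtain ⟨B, hB⟩ := h.exists_poisson
  have hW := h.doublyStochastic
  have hBc : Continuous B := B.continuous_of_finiteDimensional
  obtain ⟨K, hK0, hK⟩ : ∃ K, 0 < K ∧ ∀ v, ‖B v‖ ≤ K * ‖v‖ :=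
    (⟨B, hBc⟩ : (ι → ℝ) →L[ℝ] (ι → ℝ)).bound
  set H := K * C with hH
  have hh : ∀ t, ‖B (g t)‖ ≤ H := fun t =>
    (hK _).trans (mul_le_mul_of_nonneg_left (hC t) hK0.le)
  set e : ℕ → ι → ℝ := fun t => diffuse W α g t - fun _ => average (diffuse W α g t) with he
  -- With this corrector removed, the forcing becomes the increment of `α t • B (g t)`, which is
  -- open to summation by parts.
  set e' : ℕ → ι → ℝ := fun t => e t - α t • W.mulVec (B (g t)) with he'
  set δ : ℕ → ℝ := fun t => ‖B (g (t + 1) - g t)‖ with hδ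
  have hδ0 : Tendsto δ atTop (𝓝 0) := by
    have := (hBc.tendsto 0).comp hg
    simpa [hδ] using this.norm
  have hα0 := fun t => (hα.mem_Ioo t).1
  have hrec : ∀ t, e (t + 1) = W.mulVec (e t + α t • (B (g t) - W.mulVec (B (g t)))) := by
    intro t
    have : e t + α t • (B (g t) - W.mulVec (B (g t))) =
        (diffuse W α g t + α t • g t) + (-1 : ℝ) •
          fun _ => (average (diffuse W α g t) + α t * average (g t)) := by
      rw [hB, he]; ext; simp; ring
    rw [this, Matrix.mulVec_add, Matrix.mulVec_smul, mulVec_const hW]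
    simp only [he, diffuse, average_mulVec hW, average_add, average_smul]
    ext; simp; ring
  have hrec' : ∀ t, e' (t + 1) = W.mulVec (e' t + ((α t - α (t + 1)) • B (g (t + 1)) -
      α t • B (g (t + 1) - g t))) := by
    intro t
    simp only [he', hrec, Matrix.mulVec_add, Matrix.mulVec_sub, Matrix.mulVec_smul, map_sub,
      smul_sub, sub_smul]
    abel
  -- The decrements of the antitone `α` telescope; only the `δ` sum can grow, and it is o(elapsed
  -- time) because `δ` tends to zero.
  have hbound : ∀ T, ‖e' T‖ ≤ ‖e' 0‖ + (α 0 - α T) * H + ∑ t ∈ Finset.range T, α t * δ t := by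
    intro T
    induction T with
    | zero => simp
    | succ t ih =>
      have hd : 0 ≤ α t - α (t + 1) := sub_nonneg.2 (hα.antitone (Nat.le_succ t))
      have : ‖e' (t + 1)‖ ≤ ‖e' t‖ + ((α t - α (t + 1)) * H + α t * δ t) := by
        rw [hrec' t]
        refine (norm_mulVec_le hW _).trans ((norm_add_le _ _).trans ?_)
        gcongr
        refine (norm_sub_le _ _).trans ?_
        rw [norm_smul, norm_smul, Real.norm_of_nonneg hd, Real.norm_of_nonneg (hα0 t).le]
        gcongr
        exact hh _
      rw [Finset.sum_range_succ]
      linarith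
  have hH0 : 0 ≤ H := (norm_nonneg _).trans (hh 0)
  have hbound2 : ∀ T, ‖e T i‖ ≤ (‖e' 0‖ + 2 * α 0 * H) + ∑ t ∈ Finset.range T, α t * δ t := by
    intro T
    have h1 : ‖e T‖ ≤ ‖e' T‖ + α T * H := by
      have : e T = e' T + α T • W.mulVec (B (g T)) := by simp [he']
      rw [this]
      refine (norm_add_le _ _).trans ?_
      rw [norm_smul, Real.norm_of_nonneg (hα0 T).le]
      have := (norm_mulVec_le hW (B (g T))).trans (hh T)
      have := hα0 T
      gcongr
    have h2 := norm_le_pi_norm (e T) i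
    have h3 := hbound T
    have h4 : 0 ≤ α 0 * H := mul_nonneg (hα0 0).le hH0
    linarith
  have hlim : Tendsto (fun T => ((‖e' 0‖ + 2 * α 0 * H) + ∑ t ∈ Finset.range T, α t * δ t) /
      ∑ t ∈ Finset.range T, α t) atTop (𝓝 0) := by
    have h1 := hα.sum_eq_top.const_div_atTop (‖e' 0‖ + 2 * α 0 * H)
    have h2 := tendsto_weighted_average (fun t => (hα0 t).le) hα.sum_eq_top hδ0
    simpa [add_div] using h1.add h2
  refine squeeze_zero_norm (fun T => ?_) hlim
  rw [norm_div, Real.norm_of_nonneg (Finset.sum_nonneg fun t _ => (hα0 t).le)]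
  have : 0 ≤ ∑ t ∈ Finset.range T, α t := Finset.sum_nonneg fun t _ => (hα0 t).le
  exact div_le_div_of_nonneg_right (hbound2 T) this

end LearningGame

end

/-! ### Elapsed time, the limiting differential equation and time averages. -/

noncomputable section

namespace LearningGame

/-- Elapsed time before period `k`. -/
def clock (α : ℕ → ℝ) (k : ℕ) : ℝ := ∑ t ∈ Finset.range k, α t

theorem clock_succ (α : ℕ → ℝ) (k : ℕ) : clock α (k + 1) = clock α k + α k :=
  Finset.sum_range_succ _ _

theorem IsStepSize.clock_mono {α : ℕ → ℝ} (hα : IsStepSize α) : Monotone (clock α) :=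
  monotone_nat_of_le_succ fun k => by rw [clock_succ]; linarith [(hα.mem_Ioo k).1]

theorem IsStepSize.tendsto_zero {α : ℕ → ℝ} (hα : IsStepSize α) : Tendsto α atTop (𝓝 0) := by
  have h := hα.sq_summable.tendsto_atTop_zero.sqrt
  simpa [Real.sqrt_sq (hα.mem_Ioo _).1.le] using h

theorem IsStepSize.exists_period {α : ℕ → ℝ} (hα : IsStepSize α) (k : ℕ) (τ : ℝ) :
    ∃ j, k ≤ j ∧ τ ≤ clock α j - clock α k := by
  obtain ⟨j, hj, hj'⟩ := ((hα.sum_eq_top.eventually_ge_atTop (τ + clock α k)).and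
    (eventually_ge_atTop k)).exists
  exact ⟨j, hj', by unfold clock at *; linarith⟩

open Classical in
/-- The first period `j ≥ k` at which a time `τ` has elapsed since period `k`. -/
def IsStepSize.period {α : ℕ → ℝ} (hα : IsStepSize α) (k : ℕ) (τ : ℝ) : ℕ :=
  Nat.find (hα.exists_period k τ)

section period

variable {α : ℕ → ℝ} (hα : IsStepSize α) (k : ℕ) {τ τ' : ℝ}

theorem IsStepSize.le_period : k ≤ hα.period k τ := by
  classical exact (Nat.find_spec (hα.exists_period k τ)).1

theorem IsStepSize.le_clock_period : τ ≤ clock α (hα.period k τ) - clock α k := by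
  classical exact (Nat.find_spec (hα.exists_period k τ)).2

theorem IsStepSize.period_mono (h : τ ≤ τ') : hα.period k τ ≤ hα.period k τ' := by
  classical exact Nat.find_min' _ ⟨hα.le_period k, h.trans (hα.le_clock_period k)⟩

/-- The overshoot is at most the last step taken, which is at most `α k` and so vanishes for late
`k`. -/
theorem IsStepSize.clock_period_le (h : 0 ≤ τ) :
    clock α (hα.period k τ) - clock α k ≤ τ + α k := by
  classical
  rcases (hα.le_period k (τ := τ)).eq_or_lt with h0 | h0
  · rw [← h0]; linarith [(hα.mem_Ioo k).1]
  · obtain ⟨j, hj⟩ : ∃ j, hα.period k τ = j + 1 := ⟨hα.period k τ - 1, by omega⟩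
    have hkj : k ≤ j := by omega
    have : ¬ (k ≤ j ∧ τ ≤ clock α j - clock α k) :=
      Nat.find_min (hα.exists_period k τ) (show j < hα.period k τ by omega)
    have h1 : clock α j - clock α k < τ := by
      by_contra h2; exact this ⟨hkj, not_lt.1 h2⟩
    rw [hj, clock_succ]
    linarith [hα.antitone hkj]

theorem IsStepSize.tendsto_clock_period {β : Type*} {l : Filter β} {k : β → ℕ}
    (hk : Tendsto k l atTop) (h : 0 ≤ τ) :
    Tendsto (fun n => clock α (hα.period (k n) τ) - clock α (k n)) l (𝓝 τ) := by
  refine tendsto_of_tendsto_of_tendsto_of_le_of_le tendsto_const_nhds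
    (h := fun n => τ + α (k n)) ?_ (fun n => hα.le_clock_period _) (fun n => hα.clock_period_le _ h)
  simpa using (hα.tendsto_zero.comp hk).const_add τ

end period

/-- If from every late period on the mean of `c` over some stretch of bounded length is at most
`ε`, then `c` accumulates at a rate of at most `ε`. -/
theorem sum_le_of_stretches {α c : ℕ → ℝ} (hα : ∀ t, 0 ≤ α t) {ε M R : ℝ} {K : ℕ} (hε : 0 ≤ ε)
    (hM : 0 ≤ M) (hc : ∀ t, c t ≤ M)
    (h : ∀ k ≥ K, ∃ k' > k, clock α k' - clock α k ≤ R ∧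
      clock (α * c) k' - clock (α * c) k ≤ ε * (clock α k' - clock α k)) (T : ℕ) (hT : K ≤ T) :
    clock (α * c) T - clock (α * c) K ≤ ε * (clock α T - clock α K) + M * R := by
  have hmono : Monotone (clock α) :=
    monotone_nat_of_le_succ fun k => by rw [clock_succ]; linarith [hα k]
  have hcrude : ∀ a b, a ≤ b →
      clock (α * c) b - clock (α * c) a ≤ M * (clock α b - clock α a) := by
    intro a b hab
    induction b, hab using Nat.le_induction with
    | base => simp
    | succ b _ ih =>
      rw [clock_succ, clock_succ, Pi.mul_apply]
      nlinarith [hα b, hc b]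
  -- Greedy covering by stretches. The last one may pass `T`; its part before `T` lasts at most `R`
  -- and contributes at most `M * R`.
  have key : ∀ n k, K ≤ k → k ≤ T → T - k = n →
      clock (α * c) T - clock (α * c) k ≤ ε * (clock α T - clock α k) + M * R := by
    intro n
    induction n using Nat.strong_induction_on with
    | _ n ih =>
      intro k hk hkT hn
      obtain ⟨k', hkk', hR', hc'⟩ := h k hk
      rcases le_or_gt k' T with hle | hlt
      · have := ih (T - k') (by omega) k' (by omega) hle rfl
        linarith
      · have h1 := hcrude k T hkT
        have h2 : clock α T - clock α k ≤ R := by linarith [hmono hlt.le]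
        have h3 := mul_le_mul_of_nonneg_left h2 hM
        have h4 : 0 ≤ ε * (clock α T - clock α k) :=
          mul_nonneg hε (sub_nonneg.2 (hmono hkT))
        linarith
  exact key _ K le_rfl hT rfl

section

variable {V : Type*} [NormedAddCommGroup V] [NormedSpace ℝ V] {α : ℕ → ℝ} {x z : ℕ → V}

theorem norm_sub_sub_smul_le (hα : ∀ t, 0 ≤ α t)
    (hx : ∀ t, x (t + 1) = x t + α t • (z t - x t)) {v : V} {η : ℝ} {a b : ℕ} (hab : a ≤ b)
    (h : ∀ t, a ≤ t → t < b → ‖z t - x t - v‖ ≤ η) :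
    ‖x b - x a - (clock α b - clock α a) • v‖ ≤ η * (clock α b - clock α a) := by
  induction b, hab using Nat.le_induction with
  | base => simp
  | succ b hab ih =>
    have h1 := ih fun t h1 h2 => h t h1 (h2.trans (Nat.lt_succ_self b))
    have h2 := h b hab (Nat.lt_succ_self b)
    rw [hx, clock_succ]
    have : x b + α b • (z b - x b) - x a - (clock α b + α b - clock α a) • v =
        (x b - x a - (clock α b - clock α a) • v) + α b • (z b - x b - v) := by
      module
    rw [this]
    refine (norm_add_le _ _).trans ?_
    rw [norm_smul, Real.norm_of_nonneg (hα b)]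
    nlinarith [mul_le_mul_of_nonneg_left h2 (hα b)]

theorem norm_sub_le_clock (hα : ∀ t, 0 ≤ α t)
    (hx : ∀ t, x (t + 1) = x t + α t • (z t - x t)) {C : ℝ} (h : ∀ t, ‖z t - x t‖ ≤ C)
    (a b : ℕ) : ‖x b - x a‖ ≤ C * |clock α b - clock α a| := by
  have hmono : Monotone (clock α) :=
    monotone_nat_of_le_succ fun k => by rw [clock_succ]; linarith [hα k]
  have key : ∀ a b, a ≤ b → ‖x b - x a‖ ≤ C * |clock α b - clock α a| := by
    intro a b hab
    rw [abs_of_nonneg (sub_nonneg.2 (hmono hab))]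
    simpa using norm_sub_sub_smul_le hα hx (v := 0) hab fun t _ _ => by simpa using h t
  rcases le_total a b with hab | hab
  · exact key a b hab
  · rw [norm_sub_rev, abs_sub_comm]; exact key b a hab

/-- Limits of stretches of the averaging iteration solve the limiting differential equation. -/
theorem hasDerivWithinAt_limit (hα : IsStepSize α)
    (hx : ∀ t, x (t + 1) = x t + α t • (z t - x t)) {C : ℝ} (hC : ∀ t, ‖z t - x t‖ ≤ C)
    {l : Filter ℕ} [l.NeBot] {k : ℕ → ℕ} (hk : Tendsto k l atTop) {φ : ℝ → V}
    (hφ : ∀ τ, Tendsto (fun n => x (hα.period (k n) τ)) l (𝓝 (φ τ))) {t : ℝ} (ht : 0 ≤ t) {q : V}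
    (hq : Tendsto z (atTop ⊓ comap x (𝓝 (φ t))) (𝓝 q)) :
    HasDerivWithinAt φ (q - φ t) (Set.Ici 0) t := by
  have hα0 := fun t => (hα.mem_Ioo t).1.le
  have hC0 : 0 ≤ C := (norm_nonneg _).trans (hC 0)
  have hlip := norm_sub_le_clock hα0 hx hC
  -- near time `t`, increments are almost linear
  have main : ∀ η > 0, ∃ δ > 0, ∀ a b, 0 ≤ a → a ≤ b → |a - t| < δ → |b - t| < δ →
      ‖φ b - φ a - (b - a) • (q - φ t)‖ ≤ η * (b - a) := by
    intro η hη
    have hq' := hq.eventually (Metric.ball_mem_nhds q (half_pos hη))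
    rw [eventually_inf] at hq'
    obtain ⟨s, hs, s', hs', hss⟩ := hq'
    obtain ⟨K, hK⟩ := mem_atTop_sets.1 hs
    obtain ⟨u, hu, hus⟩ := mem_comap.1 hs'
    obtain ⟨ρ', hρ', hρu⟩ := Metric.mem_nhds_iff.1 hu
    set ρ := min ρ' (η / 2) with hρdef
    have hρ : 0 < ρ := lt_min hρ' (half_pos hη)
    have hz : ∀ j ≥ K, ‖x j - φ t‖ < ρ → ‖z j - x j - (q - φ t)‖ ≤ η := by
      intro j hj hxj
      have h1 : x j ∈ Metric.ball (φ t) ρ' := by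
        rw [mem_ball_iff_norm]; exact hxj.trans_le (min_le_left _ _)
      have h2 : z j ∈ Metric.ball q (η / 2) := hss j ⟨hK j hj, hus (hρu h1)⟩
      rw [mem_ball_iff_norm] at h2
      have h3 : z j - x j - (q - φ t) = (z j - q) - (x j - φ t) := by abel
      rw [h3]
      have := norm_sub_le (z j - q) (x j - φ t)
      have := min_le_right ρ' (η / 2)
      linarith
    -- At speed at most `C`, the iterates move at most `ρ / 2` in such a window; the other `ρ / 2`
    -- pays for convergence to `φ t`.
    refine ⟨ρ / (2 * (C + 1)), by positivity, fun a b ha hab hat hbt => ?_⟩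
    set δ := ρ / (2 * (C + 1)) with hδ
    have hCδ : C * δ ≤ ρ / 2 := by
      rw [hδ, ← mul_div_assoc, div_le_div_iff₀ (by positivity) (by positivity)]
      nlinarith
    have hσa := hα.tendsto_clock_period hk ha
    have hσb := hα.tendsto_clock_period hk (ha.trans hab)
    have hσt := hα.tendsto_clock_period hk ht
    have e1 := (hσa.sub hσt).abs.eventually (gt_mem_nhds hat)
    have e2 := (hσb.sub hσt).abs.eventually (gt_mem_nhds hbt)
    have e3 : ∀ᶠ n in l, ‖x (hα.period (k n) t) - φ t‖ < ρ / 2 := by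
      have := (hφ t).eventually (Metric.ball_mem_nhds (φ t) (half_pos hρ))
      simpa [dist_eq_norm] using this
    have e4 := hk.eventually_ge_atTop K
    have e : ∀ᶠ n in l, ‖x (hα.period (k n) b) - x (hα.period (k n) a) -
        ((clock α (hα.period (k n) b) - clock α (k n)) -
          (clock α (hα.period (k n) a) - clock α (k n))) • (q - φ t)‖ ≤
        η * ((clock α (hα.period (k n) b) - clock α (k n)) -
          (clock α (hα.period (k n) a) - clock α (k n))) := by
      filter_upwards [e1, e2, e3, e4] with n e1 e2 e3 e4
      rw [sub_sub_sub_cancel_right]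
      refine norm_sub_sub_smul_le hα0 hx (hα.period_mono _ hab) fun j hj hj' => hz j ?_ ?_
      · exact e4.trans ((hα.le_period _).trans hj)
      · have h1 := hlip (hα.period (k n) t) j
        have h2 : |clock α j - clock α (hα.period (k n) t)| ≤ δ := by
          rw [sub_sub_sub_cancel_right, abs_lt] at e1 e2
          rw [abs_le]
          have := hα.clock_mono hj
          have := hα.clock_mono hj'.le
          constructor <;> linarith
        have h3 := mul_le_mul_of_nonneg_left h2 hC0
        have h4 : x j - φ t = (x j - x (hα.period (k n) t)) + (x (hα.period (k n) t) - φ t) := by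
          abel
        rw [h4]
        refine (norm_add_le _ _).trans_lt ?_
        linarith
    exact le_of_tendsto_of_tendsto
      (((hφ b).sub (hφ a)).sub ((hσb.sub hσa).smul_const _)).norm
      ((hσb.sub hσa).const_mul η) e
  rw [hasDerivWithinAt_iff_isLittleO, Asymptotics.isLittleO_iff]
  intro η hη
  obtain ⟨δ, hδ, h⟩ := main η hη
  filter_upwards [inter_mem_nhdsWithin (Set.Ici 0) (Metric.ball_mem_nhds t hδ)] with s hs
  have hs0 : (0 : ℝ) ≤ s := hs.1
  have hst : |s - t| < δ := hs.2
  rcases le_total t s with hts | hts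
  · rw [Real.norm_of_nonneg (sub_nonneg.2 hts)]
    exact h t s ht hts (by simpa using hδ) hst
  · rw [Real.norm_of_nonpos (sub_nonpos.2 hts)]
    have := h s t hs0 hts hst (by simpa using hδ)
    have heq : φ s - φ t - (s - t) • (q - φ t) = -(φ t - φ s - (t - s) • (q - φ t)) := by module
    rwa [neg_sub, heq, norm_neg]

/-- Time averages along the averaging iteration concentrate at a point that attracts every
solution of the limiting differential equation. No stability of that point is needed. -/
theorem tendsto_time_average (hα : IsStepSize α) {X : Set V} (hX : IsCompact X)
    (hxX : ∀ t, x t ∈ X) (hzX : ∀ t, z t ∈ X) (hx : ∀ t, x (t + 1) = x t + α t • (z t - x t))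
    {F : V → V} (hF : ∀ p ∈ X, Tendsto z (atTop ⊓ comap x (𝓝 p)) (𝓝 (F p))) {xs : V}
    (hxs : xs ∈ X)
    (hsol : ∀ φ : ℝ → V, (∀ t, 0 ≤ t → φ t ∈ X ∧
      HasDerivWithinAt φ (F (φ t) - φ t) (Set.Ici 0) t) → Tendsto φ atTop (𝓝 xs))
    {g : V → ℝ} (hg : ContinuousOn g X) :
    Tendsto (fun T => clock (fun t => α t * g (x t)) T / clock α T) atTop (𝓝 (g xs)) := by
  have hα0 := fun t => (hα.mem_Ioo t).1.le
  obtain ⟨C, hC0, hC⟩ : ∃ C, 0 ≤ C ∧ ∀ t, ‖z t - x t‖ ≤ C := by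
    obtain ⟨D, hD⟩ := hX.isBounded.exists_norm_le
    refine ⟨D + D, ?_, fun t => (norm_sub_le _ _).trans (add_le_add (hD _ (hzX t)) (hD _ (hxX t)))⟩
    have := (norm_nonneg _).trans (hD _ hxs)
    linarith
  have hlip := norm_sub_le_clock hα0 hx hC
  set c : V → ℝ := fun p => |g p - g xs| with hc
  have hcc : ContinuousOn c X := (hg.sub continuousOn_const).abs
  obtain ⟨M, hM⟩ : ∃ M, ∀ p ∈ X, c p ≤ M := by
    obtain ⟨M, hM⟩ := (hX.image_of_continuousOn hcc).bddAbove
    exact ⟨M, fun p hp => hM ⟨p, hp, rfl⟩⟩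
  have hM0 : 0 ≤ M := (abs_nonneg _).trans (hM xs hxs)
  set S : ℕ → ℝ := clock (α * fun t => c (x t)) with hS
  have hSle : ∀ a b η, a ≤ b → (∀ t, a ≤ t → t < b → c (x t) ≤ η) →
      S b - S a ≤ η * (clock α b - clock α a) := by
    intro a b η hab h
    induction b, hab using Nat.le_induction with
    | base => simp
    | succ b hab ih =>
      have h1 := ih fun t h1 h2 => h t h1 (h2.trans (Nat.lt_succ_self b))
      have h2 := mul_le_mul_of_nonneg_left (h b hab (Nat.lt_succ_self b)) (hα0 b)
      rw [hS, clock_succ, clock_succ, ← hS, Pi.mul_apply]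
      linarith
  -- A single `n` bounds both the starting period from below and the length from above, so failure
  -- for every `n` produces starts `k n → ∞` with no good stretch of length up to `n`.
  have stretches : ∀ ε > 0, ∃ n : ℕ, ∀ k ≥ n, ∃ k' > k, clock α k' - clock α k ≤ n ∧
      S k' - S k ≤ ε * (clock α k' - clock α k) := by
    intro ε hε
    by_contra! hcon
    choose k hkn hk using hcon
    have hkt : Tendsto k (hyperfilter ℕ : Filter ℕ) atTop :=
      (tendsto_atTop_mono hkn tendsto_id).mono_left Nat.hyperfilter_le_atTop
    -- An ultrafilter yields limits at all real times at once, with no diagonal extraction.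
    have hlim : ∀ τ, ∃ p ∈ X,
        Tendsto (fun n => x (hα.period (k n) τ)) (hyperfilter ℕ : Filter ℕ) (𝓝 p) := by
      intro τ
      exact hX.ultrafilter_le_nhds' ((hyperfilter ℕ).map fun n => x (hα.period (k n) τ))
        (Ultrafilter.mem_map.2 (Eventually.of_forall fun n => hxX _))
    choose φ hφX hφ using hlim
    have hφs : Tendsto φ atTop (𝓝 xs) := hsol φ fun t ht =>
      ⟨hφX t, hasDerivWithinAt_limit hα hx hC hkt hφ ht (hF _ (hφX t))⟩
    have hcφ : Tendsto (fun τ => c (φ τ)) atTop (𝓝 0) := by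
      have h1 : Tendsto φ atTop (𝓝[X] xs) :=
        tendsto_nhdsWithin_iff.2 ⟨hφs, Eventually.of_forall hφX⟩
      have h2 := (hcc xs hxs).tendsto.comp h1
      simpa [hc, Function.comp_def] using h2
    obtain ⟨τ₀, hτ₀, hτ⟩ : ∃ τ₀ ≥ (0 : ℝ), ∀ τ ≥ τ₀, c (φ τ) < ε / 4 := by
      obtain ⟨τ₀, h0⟩ := eventually_atTop.1
        (hcφ.eventually (gt_mem_nhds (show 0 < ε / 4 by linarith)))
      exact ⟨max τ₀ 0, le_max_right _ _, fun τ h => h0 τ ((le_max_left _ _).trans h)⟩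
    have huc := hX.uniformContinuousOn_of_continuous hcc
    obtain ⟨ρ, hρ, huc⟩ := Metric.uniformContinuousOn_iff.1 huc (ε / 4) (by linarith)
    -- Convergence to `φ` is only pointwise in time, so it is used at finitely many grid times.
    -- Between them elapsed time stays below `2 * δ`, which changes `c` by less than `ε / 4`.
    set δ := ρ / (2 * (C + 1)) with hδdef
    have hδ : 0 < δ := by positivity
    have hCδ : C * (2 * δ) < ρ := by
      have : ρ = (C + 1) * (2 * δ) := by rw [hδdef]; field_simp
      nlinarith
    have step : ∀ a ≥ τ₀, ∀ᶠ n in (hyperfilter ℕ : Filter ℕ),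
        S (hα.period (k n) (a + δ)) - S (hα.period (k n) a) ≤
          ε / 2 * (clock α (hα.period (k n) (a + δ)) - clock α (hα.period (k n) a)) := by
      intro a ha
      have hσ := (hα.tendsto_clock_period hkt (show 0 ≤ a + δ by linarith)).sub
        (hα.tendsto_clock_period hkt (show 0 ≤ a by linarith))
      have e1 := hσ.eventually (gt_mem_nhds (show a + δ - a < 2 * δ by linarith))
      have e2 : ∀ᶠ n in (hyperfilter ℕ : Filter ℕ), c (x (hα.period (k n) a)) < ε / 4 := by
        have h1 : Tendsto (fun n => x (hα.period (k n) a)) (hyperfilter ℕ : Filter ℕ)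
            (𝓝[X] (φ a)) :=
          tendsto_nhdsWithin_iff.2 ⟨hφ a, Eventually.of_forall fun n => hxX _⟩
        exact ((hcc _ (hφX a)).tendsto.comp h1).eventually (gt_mem_nhds (hτ a ha))
      filter_upwards [e1, e2] with n e1 e2
      refine hSle _ _ _ (hα.period_mono _ (by linarith)) fun j hj hj' => ?_
      have h1 := hlip (hα.period (k n) a) j
      have h2 := hα.clock_mono hj
      have h3 := hα.clock_mono hj'.le
      rw [abs_of_nonneg (sub_nonneg.2 h2)] at h1
      have h4 : dist (x j) (x (hα.period (k n) a)) < ρ := by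
        rw [dist_eq_norm]
        refine h1.trans_lt (lt_of_le_of_lt (mul_le_mul_of_nonneg_left ?_ hC0) hCδ)
        linarith
      have h5 := huc _ (hxX j) _ (hxX _) h4
      rw [Real.dist_eq, abs_lt] at h5
      linarith
    have steps : ∀ j : ℕ, ∀ᶠ n in (hyperfilter ℕ : Filter ℕ),
        S (hα.period (k n) (τ₀ + j * δ)) - S (hα.period (k n) τ₀) ≤
          ε / 2 * (clock α (hα.period (k n) (τ₀ + j * δ)) - clock α (hα.period (k n) τ₀)) := by
      intro j
      induction j with
      | zero => simp
      | succ j ih =>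
        filter_upwards [ih, step (τ₀ + j * δ) (by nlinarith [mul_nonneg j.cast_nonneg hδ.le])]
          with n h1 h2
        have : τ₀ + ((j + 1 : ℕ) : ℝ) * δ = τ₀ + j * δ + δ := by push_cast; ring
        rw [this]
        linarith
    -- Enough grid steps to outweigh the transient cost `M * τ₀`; the `+ 1` makes `τ₁` positive, so
    -- that the stretch is nonempty.
    obtain ⟨j, hj⟩ := exists_nat_gt ((2 * M * τ₀ / ε + 1) / δ)
    rw [div_lt_iff₀ hδ] at hj
    have hjδ : 2 * M * τ₀ < ε * (j * δ) := by
      have h1 : 2 * M * τ₀ / ε < j * δ := by linarith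
      rw [div_lt_iff₀ hε] at h1
      linarith
    have hq : 0 ≤ 2 * M * τ₀ / ε := by positivity
    set τ₁ := τ₀ + j * δ with hτ₁
    have hτ₁0 : 1 < τ₁ := by linarith
    have hσ₀ := hα.tendsto_clock_period hkt hτ₀
    have hσ₁ := hα.tendsto_clock_period hkt (show 0 ≤ τ₁ by linarith)
    have e1 := hσ₁.eventually (gt_mem_nhds (show τ₁ < τ₁ + 1 by linarith))
    have e2 : ∀ᶠ n : ℕ in (hyperfilter ℕ : Filter ℕ), τ₁ + 1 ≤ n :=
      ((tendsto_natCast_atTop_atTop (R := ℝ)).eventually_ge_atTop _).filter_mono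
        Nat.hyperfilter_le_atTop
    have e : ∀ᶠ n in (hyperfilter ℕ : Filter ℕ),
        ε * (clock α (hα.period (k n) τ₁) - clock α (k n)) ≤
          M * (clock α (hα.period (k n) τ₀) - clock α (k n)) +
            ε / 2 * ((clock α (hα.period (k n) τ₁) - clock α (k n)) -
              (clock α (hα.period (k n) τ₀) - clock α (k n))) := by
      filter_upwards [e1, e2, steps j] with n e1 e2 e3
      have h1 : k n < hα.period (k n) τ₁ := by
        refine (hα.le_period (k n) (τ := τ₁)).lt_of_ne fun h => ?_
        have := hα.le_clock_period (k n) (τ := τ₁)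
        rw [← h, sub_self] at this
        linarith
      have h2 := hk n _ h1 (e1.le.trans e2)
      have h3 := hSle (k n) (hα.period (k n) τ₀) M (hα.le_period _) fun t _ _ => hM _ (hxX t)
      rw [sub_sub_sub_cancel_right]
      linarith
    -- In the limit `ε * τ₁ ≤ M * τ₀ + ε / 2 * (τ₁ - τ₀)`, against the choice of `j`.
    have := le_of_tendsto_of_tendsto (hσ₁.const_mul ε)
      ((hσ₀.const_mul M).add ((hσ₁.sub hσ₀).const_mul (ε / 2))) e
    nlinarith
  rw [tendsto_iff_norm_sub_tendsto_zero, Metric.tendsto_atTop]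
  intro ε hε
  obtain ⟨K, hK⟩ := stretches (ε / 2) (half_pos hε)
  have hT := sum_le_of_stretches hα0 (half_pos hε).le hM0 (fun t => hM _ (hxX t)) hK
  have hlim : Tendsto (fun T => (S K + M * K) / clock α T) atTop (𝓝 0) :=
    hα.sum_eq_top.const_div_atTop _
  obtain ⟨T₀, hT₀⟩ := eventually_atTop.1 (((hlim.eventually (gt_mem_nhds (half_pos hε))).and
    (eventually_ge_atTop K)).and (hα.sum_eq_top.eventually_gt_atTop 0))
  refine ⟨T₀, fun T hTT => ?_⟩
  obtain ⟨⟨h1, h2⟩, h3 : 0 < clock α T⟩ := hT₀ T hTT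
  have h4 := hT T h2
  rw [← hS] at h4
  have h5 : |clock (fun t => α t * g (x t)) T - g xs * clock α T| ≤ S T := by
    have : clock (fun t => α t * g (x t)) T - g xs * clock α T =
        ∑ t ∈ Finset.range T, α t * (g (x t) - g xs) := by
      simp only [clock, mul_sub, Finset.sum_sub_distrib, ← Finset.sum_mul]; ring
    rw [this]
    refine (Finset.abs_sum_le_sum_abs _ _).trans (le_of_eq (Finset.sum_congr rfl fun t _ => ?_))
    rw [abs_mul, abs_of_nonneg (hα0 t)]; rfl
  rw [Real.dist_0_eq_abs, abs_norm, Real.norm_eq_abs]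
  have h6 : clock (fun t => α t * g (x t)) T / clock α T - g xs =
      (clock (fun t => α t * g (x t)) T - g xs * clock α T) / clock α T := by
    field_simp
  rw [h6, abs_div, abs_of_pos h3, div_lt_iff₀ h3]
  rw [div_lt_iff₀ h3] at h1
  have h7 : 0 ≤ ε / 2 * clock α K :=
    mul_nonneg (half_pos hε).le (Finset.sum_nonneg fun t _ => hα0 t)
  linarith

end

end LearningGame

end

/-! ### Likelihoods, divergences and their continuity. -/

noncomputable section

namespace LearningGame

variable {ι Θ : Type*} {d : ι → ℕ}

namespace Game

/-- The log-likelihood ratio of the parameters `θs` and `θ` at the realized cost `y`. -/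
def logRatio (G : Game ι Θ d) (θs θ : Θ) (j : ι) (x : Profile d) (y : ℝ) : ℝ :=
  Real.log (G.f j y x θs / G.f j y x θ)

/-- The mean log-likelihood ratio under the parameter `θs`. -/
def info (G : Game ι Θ d) (θs θ : Θ) (j : ι) (x : Profile d) : ℝ :=
  ∫ y, G.f j y x θs * G.logRatio θs θ j x y ∂(G.ref j)

variable {G : Game ι Θ d} {θs θ : Θ} {j : ι} {x : Profile d}

theorem IsModel.lintegral_f (hG : G.IsModel) (hx : x ∈ G.profiles) :
    ∫⁻ y, ENNReal.ofReal (G.f j y x θ) ∂(G.ref j) = 1 := by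
  have := (hG.law_prob j x hx θ).measure_univ
  rwa [law, withDensity_apply _ MeasurableSet.univ, Measure.restrict_univ] at this

theorem IsModel.integrable_f (hG : G.IsModel) (hx : x ∈ G.profiles) :
    Integrable (fun y => G.f j y x θ) (G.ref j) := by
  refine ⟨(hG.f_measurable j x hx θ).aestronglyMeasurable, ?_⟩
  rw [hasFiniteIntegral_iff_ofReal (Eventually.of_forall fun y => hG.f_nonneg j y x hx θ),
    hG.lintegral_f hx]
  exact ENNReal.one_lt_top

theorem IsModel.integral_f (hG : G.IsModel) (hx : x ∈ G.profiles) :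
    ∫ y, G.f j y x θ ∂(G.ref j) = 1 := by
  rw [integral_eq_lintegral_of_nonneg_ae
    (Eventually.of_forall fun y => hG.f_nonneg j y x hx θ)
    (hG.f_measurable j x hx θ).aestronglyMeasurable, hG.lintegral_f hx]
  rfl

theorem IsModel.measurable_logRatio (hG : G.IsModel) (hx : x ∈ G.profiles) :
    Measurable (G.logRatio θs θ j x) :=
  ((hG.f_measurable j x hx θs).div (hG.f_measurable j x hx θ)).log

theorem IsModel.integral_law (hG : G.IsModel) (hx : x ∈ G.profiles) (h : ℝ → ℝ) :
    ∫ y, h y ∂(G.law j x θ) = ∫ y, G.f j y x θ * h y ∂(G.ref j) := by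
  rw [law, integral_withDensity_eq_integral_toReal_smul
    (hG.f_measurable j x hx θ).ennreal_ofReal (by simp)]
  refine integral_congr_ae (Eventually.of_forall fun y => ?_)
  simp [ENNReal.toReal_ofReal (hG.f_nonneg j y x hx θ)]

/-- Where the denominator vanishes, `common_support` makes the numerator vanish too, so the value of
`0 / 0` is immaterial. -/
theorem BoundedInformation.law_eq (h : G.BoundedInformation) (hG : G.IsModel)
    (hx : x ∈ G.profiles) : G.law j x θs =
      (G.law j x θ).withDensity fun y => ENNReal.ofReal (G.f j y x θs / G.f j y x θ) := by
  have hm := (hG.f_measurable j x hx θ).ennreal_ofReal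
  have hm' : Measurable fun y => ENNReal.ofReal (G.f j y x θs / G.f j y x θ) :=
    ((hG.f_measurable j x hx θs).div (hG.f_measurable j x hx θ)).ennreal_ofReal
  rw [law, law, ← withDensity_mul _ hm hm']
  congr 1
  ext y
  rw [Pi.mul_apply, ← ENNReal.ofReal_mul (hG.f_nonneg j y x hx θ)]
  by_cases h0 : G.f j y x θ = 0
  · simp [h0, h.common_support j y x hx θs θ h0]
  · rw [mul_div_cancel₀ _ h0]

/-- A bounded log-ratio is integrable, so the divergence is finite and real-valued integrals can
replace it from here on. -/
theorem BoundedInformation.klDiv_eq (h : G.BoundedInformation) (hG : G.IsModel)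
    (hx : x ∈ G.profiles) :
    0 ≤ G.info θs θ j x ∧
      InformationTheory.klDiv (G.law j x θs) (G.law j x θ) = ENNReal.ofReal (G.info θs θ j x) := by
  have := hG.law_prob j x hx θs
  have := hG.law_prob j x hx θ
  obtain ⟨L, -, hL⟩ := h.bounded
  have hm' : Measurable fun y => ENNReal.ofReal (G.f j y x θs / G.f j y x θ) :=
    ((hG.f_measurable j x hx θs).div (hG.f_measurable j x hx θ)).ennreal_ofReal
  have hac : G.law j x θs ≪ G.law j x θ := by
    rw [h.law_eq hG hx (θs := θs) (θ := θ)]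
    exact withDensity_absolutelyContinuous _ _
  have hrn : (G.law j x θs).rnDeriv (G.law j x θ) =ᵐ[G.law j x θ]
      fun y => ENNReal.ofReal (G.f j y x θs / G.f j y x θ) := by
    conv_lhs => rw [h.law_eq hG hx (θs := θs) (θ := θ)]
    exact Measure.rnDeriv_withDensity _ hm'
  have hllr : llr (G.law j x θs) (G.law j x θ) =ᵐ[G.law j x θs] G.logRatio θs θ j x := by
    filter_upwards [hac.ae_le hrn] with y hy
    rw [llr, hy, ENNReal.toReal_ofReal
      (div_nonneg (hG.f_nonneg j y x hx θs) (hG.f_nonneg j y x hx θ)), logRatio]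
  have hint : Integrable (llr (G.law j x θs) (G.law j x θ)) (G.law j x θs) := by
    refine (Integrable.of_bound (hG.measurable_logRatio hx).aestronglyMeasurable L
      (Eventually.of_forall fun y => ?_)).congr hllr.symm
    exact hL j θs θ x hx y
  have hI : ∫ y, llr (G.law j x θs) (G.law j x θ) y ∂(G.law j x θs) = G.info θs θ j x := by
    rw [integral_congr_ae hllr, hG.integral_law hx, info]
  constructor
  · have := InformationTheory.integral_llr_add_sub_measure_univ_nonneg hac hint
    rw [hI] at this
    simpa using this
  · rw [InformationTheory.klDiv_of_ac_of_integrable hac hint, hI]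
    simp

/-- Convergence in mean of the densities. -/
theorem IsModel.tendsto_integral_abs_sub [Finite ι] (hG : G.IsModel) (h : G.BoundedInformation)
    (hx : x ∈ G.profiles) :
    Tendsto (fun p => ∫ y, |G.f j y p θ - G.f j y x θ| ∂(G.ref j)) (𝓝[G.profiles] x) (𝓝 0) := by
  -- Scheffé's argument: this positive part is dominated by the density at `x`, and as both
  -- densities have integral one, its integral is half the L¹ distance.
  have hpos : Tendsto (fun p => ∫ y, max (G.f j y x θ - G.f j y p θ) 0 ∂(G.ref j))
      (𝓝[G.profiles] x) (𝓝 0) := by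
    have := tendsto_integral_filter_of_dominated_convergence (μ := G.ref j)
      (l := 𝓝[G.profiles] x) (F := fun p y => max (G.f j y x θ - G.f j y p θ) 0)
      (f := fun _ => (0 : ℝ)) (fun y => G.f j y x θ) ?_ ?_ (hG.integrable_f hx) ?_
    · simpa using this
    · filter_upwards [self_mem_nhdsWithin] with p hp
      exact (((hG.f_measurable j x hx θ).sub (hG.f_measurable j p hp θ)).max
        measurable_const).aestronglyMeasurable
    · filter_upwards [self_mem_nhdsWithin] with p hp
      refine Eventually.of_forall fun y => ?_
      rw [Real.norm_of_nonneg (le_max_right _ _)]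
      have h1 := hG.f_nonneg j y p hp θ
      have h2 := hG.f_nonneg j y x hx θ
      exact max_le (by linarith) h2
    · refine Eventually.of_forall fun y => ?_
      have := ((h.continuous j y θ x hx).tendsto.const_sub (G.f j y x θ)).max
        (tendsto_const_nhds (x := (0 : ℝ)))
      simpa using this
  have h2 := hpos.const_mul 2
  rw [mul_zero] at h2
  refine h2.congr' ?_
  filter_upwards [self_mem_nhdsWithin] with p hp
  have hp' : ∀ y, |G.f j y p θ - G.f j y x θ| =
      (G.f j y p θ - G.f j y x θ) + 2 * max (G.f j y x θ - G.f j y p θ) 0 := by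
    intro y
    rcases le_total (G.f j y x θ) (G.f j y p θ) with h | h
    · rw [abs_of_nonneg (by linarith), max_eq_right (by linarith)]; ring
    · rw [abs_of_nonpos (by linarith), max_eq_left (by linarith)]; ring
  have i1 : Integrable (fun y => G.f j y p θ - G.f j y x θ) (G.ref j) :=
    (hG.integrable_f hp).sub (hG.integrable_f hx)
  have i2 : Integrable (fun y => max (G.f j y x θ - G.f j y p θ) 0) (G.ref j) :=
    ((hG.integrable_f hx).sub (hG.integrable_f hp)).pos_part
  simp_rw [hp']
  rw [integral_add i1 (i2.const_mul 2), integral_sub (hG.integrable_f hp) (hG.integrable_f hx),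
    hG.integral_f hp, hG.integral_f hx, integral_const_mul]
  ring

/-- Density and log-ratio both move with the profile. With the density frozen at `x`, dominated
convergence applies; the remainder is at most `L` times the L¹ distance of the densities. -/
theorem IsModel.continuousOn_info [Finite ι] (hG : G.IsModel) (h : G.BoundedInformation) :
    ContinuousOn (G.info θs θ j) G.profiles := by
  intro x hx
  obtain ⟨L, hL0, hL⟩ := h.bounded
  have hbd : ∀ p ∈ G.profiles, ∀ y, |G.logRatio θs θ j p y| ≤ L := fun p hp y =>
    hL j θs θ p hp y
  have h1 : Tendsto (fun p => ∫ y, G.f j y x θs * G.logRatio θs θ j p y ∂(G.ref j))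
      (𝓝[G.profiles] x) (𝓝 (G.info θs θ j x)) := by
    refine tendsto_integral_filter_of_dominated_convergence (fun y => G.f j y x θs * L) ?_ ?_
      ((hG.integrable_f hx).mul_const L) ?_
    · filter_upwards [self_mem_nhdsWithin] with p hp
      exact ((hG.f_measurable j x hx θs).mul (hG.measurable_logRatio hp)).aestronglyMeasurable
    · filter_upwards [self_mem_nhdsWithin] with p hp
      refine Eventually.of_forall fun y => ?_
      rw [norm_mul, Real.norm_of_nonneg (hG.f_nonneg j y x hx θs)]
      exact mul_le_mul_of_nonneg_left (hbd p hp y) (hG.f_nonneg j y x hx θs)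
    · refine Eventually.of_forall fun y => ?_
      by_cases h0 : G.f j y x θs = 0
      · simpa [h0] using tendsto_const_nhds
      · have h0' : G.f j y x θ ≠ 0 := fun h' => h0 (h.common_support j y x hx θs θ h')
        refine Tendsto.const_mul _ ?_
        exact ((h.continuous j y θs x hx).tendsto.div (h.continuous j y θ x hx).tendsto h0').log
          (div_ne_zero h0 h0')
  have h2 : Tendsto (fun p => ∫ y, (G.f j y p θs - G.f j y x θs) * G.logRatio θs θ j p y
      ∂(G.ref j)) (𝓝[G.profiles] x) (𝓝 0) := by
    have h3 := (hG.tendsto_integral_abs_sub h hx (θ := θs) (j := j)).mul_const L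
    rw [zero_mul] at h3
    refine squeeze_zero_norm' ?_ h3
    filter_upwards [self_mem_nhdsWithin] with p hp
    rw [← integral_mul_const]
    refine norm_integral_le_of_norm_le ?_ (Eventually.of_forall fun y => ?_)
    · exact (((hG.integrable_f hp).sub (hG.integrable_f hx)).abs).mul_const L
    · rw [norm_mul]
      exact mul_le_mul_of_nonneg_left (hbd p hp y) (abs_nonneg _)
  have h4 := h1.add h2
  rw [add_zero] at h4
  refine h4.congr' ?_
  filter_upwards [self_mem_nhdsWithin] with p hp
  have i : ∀ q ∈ G.profiles, Integrable (fun y => G.f j y q θs * G.logRatio θs θ j p y)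
      (G.ref j) := fun q hq =>
    (hG.integrable_f hq).mul_bdd (c := L) (hG.measurable_logRatio hp).aestronglyMeasurable
      (Eventually.of_forall fun y => hbd p hp y)
  simp only [sub_mul]
  rw [integral_sub (i p hp) (i x hx), info]
  ring

theorem IsModel.isCompact_profiles (hG : G.IsModel) : IsCompact G.profiles := by
  have : G.profiles = Set.univ.pi G.strat := by ext; simp [profiles]
  rw [this]
  exact isCompact_univ_pi hG.compact_strat

/-! ### Best responses at a point mass. -/

section BestResponse

theorem update_mem_profiles [DecidableEq ι] (hx : x ∈ G.profiles) {i : ι}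
    {z : EuclideanSpace ℝ (Fin (d i))} (hz : z ∈ G.strat i) : Function.update x i z ∈ G.profiles := by
  intro k
  rcases eq_or_ne k i with rfl | h
  · simpa using hz
  · simpa [h] using hx k

theorem expCost_single [Fintype Θ] [DecidableEq Θ] (i : ι) :
    G.expCost i x (Pi.single θs 1) = G.cost i x θs := by
  simp [expCost, Pi.single_apply]

variable [Fintype Θ] [DecidableEq ι] [DecidableEq Θ]

theorem IsModel.exists_bestResponse (hG : G.IsModel) (h5 : G.ConvexCosts) (hx : x ∈ G.profiles)
    (i : ι) : (G.bestResponse i x (Pi.single θs 1)).Nonempty := by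
  have hc : ContinuousOn (fun z => G.cost i (Function.update x i z) θs) (G.strat i) :=
    (h5.continuous i θs).comp
      ((continuous_const (y := x)).update i (continuous_id : Continuous
        fun z : EuclideanSpace ℝ (Fin (d i)) => z)).continuousOn
      fun z hz => update_mem_profiles hx hz
  obtain ⟨z, hz, hmin⟩ := (hG.compact_strat i).exists_isMinOn ⟨x i, hx i⟩ hc
  exact ⟨z, hz, fun z' hz' => by simpa [expCost_single] using hmin hz'⟩

theorem ConvexCosts.bestResponse_unique (h5 : G.ConvexCosts) (hx : x ∈ G.profiles) {i : ι}
    {z z' : EuclideanSpace ℝ (Fin (d i))} (hz : z ∈ G.bestResponse i x (Pi.single θs 1))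
    (hz' : z' ∈ G.bestResponse i x (Pi.single θs 1)) : z = z' := by
  simp only [bestResponse, expCost_single, Set.mem_ofPred_eq] at hz hz'
  exact (h5.strictConvex i θs x hx).eq_of_isMinOn (fun w hw => hz.2 w hw)
    (fun w hw => hz'.2 w hw) hz.1 hz'.1

/-- Best responses depend continuously on the profile and the belief. -/
theorem ConvexCosts.tendsto_bestResponse (h5 : G.ConvexCosts) (hG : G.IsModel) {i : ι}
    {l : Filter ℕ} {xt : ℕ → Profile d} {m : ℕ → Θ → ℝ} {zt : ℕ → EuclideanSpace ℝ (Fin (d i))}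
    (hz : ∀ t, zt t ∈ G.bestResponse i (xt t) (m t)) (hxt : ∀ t, xt t ∈ G.profiles)
    (hx : x ∈ G.profiles) (hl : Tendsto xt l (𝓝 x)) (hm : Tendsto m l (𝓝 (Pi.single θs 1)))
    {z : EuclideanSpace ℝ (Fin (d i))} (hzx : z ∈ G.bestResponse i x (Pi.single θs 1)) :
    Tendsto zt l (𝓝 z) := by
  -- By compactness a limit exists along each ultrafilter. Minimality passes to the limit, so it is
  -- a best response at `x`, hence equals `z` by uniqueness.
  rw [tendsto_iff_ultrafilter]
  intro U hU
  obtain ⟨w, hw, hUw⟩ := (hG.compact_strat i).ultrafilter_le_nhds' (U.map zt)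
    (Ultrafilter.mem_map.2 (Eventually.of_forall fun t => (hz t).1))
  have hzU : Tendsto zt U (𝓝 w) := hUw
  have hcost : ∀ (v : ℕ → EuclideanSpace ℝ (Fin (d i))) (v' : EuclideanSpace ℝ (Fin (d i))),
      (∀ t, v t ∈ G.strat i) → v' ∈ G.strat i → Tendsto v U (𝓝 v') →
      Tendsto (fun t => G.expCost i (Function.update (xt t) i (v t)) (m t)) U
        (𝓝 (G.expCost i (Function.update x i v') (Pi.single θs 1))) := by
    intro v v' hv hv' hvU
    refine tendsto_finsetSum _ fun θ _ => ?_
    refine ((tendsto_pi_nhds.1 hm θ).mono_left hU).mul ?_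
    refine (h5.continuous i θ _ (update_mem_profiles hx hv')).tendsto.comp
      (tendsto_nhdsWithin_iff.2 ⟨(hl.mono_left hU).update i hvU, ?_⟩)
    exact Eventually.of_forall fun t => update_mem_profiles (hxt t) (hv t)
  have hwBR : w ∈ G.bestResponse i x (Pi.single θs 1) :=
    ⟨hw, fun z' hz' => le_of_tendsto_of_tendsto (hcost zt w (fun t => (hz t).1) hw hzU)
      (hcost (fun _ => z') z' (fun _ => hz') hz' tendsto_const_nhds)
      (Eventually.of_forall fun t => (hz t).2 z' hz')⟩
  rw [h5.bestResponse_unique hx hzx hwBR]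
  exact hzU

end BestResponse

/-- A global attractor of the best-response dynamics is the only Nash equilibrium. -/
theorem BRConverges.exists_unique [Fintype Θ] [DecidableEq ι] {m : Θ → ℝ}
    (h : G.BRConverges m) :
    ∃ xs, (∀ x', G.IsNash m x' ↔ x' = xs) ∧
      ∀ xbar, G.IsBRSolution m xbar → Tendsto xbar atTop (𝓝 xs) := by
  obtain ⟨xs, hxs, hsol⟩ := h
  refine ⟨xs, fun x' => ⟨fun hx' => ?_, fun hx' => hx' ▸ hxs⟩, hsol⟩
  -- An equilibrium is a stationary solution, which can converge only to itself.
  have hconst : G.IsBRSolution m fun _ => x' := by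
    refine fun t _ => ⟨hx'.1, fun i => ⟨x' i, ⟨hx'.1 i, fun z' hz' => ?_⟩, ?_⟩⟩
    · simpa using hx'.2 i z' hz'
    · simpa using hasDerivWithinAt_const t (Set.Ici 0) (x' i)
  exact tendsto_nhds_unique tendsto_const_nhds (hsol _ hconst)

end Game

end LearningGame

end

/-! ### Martingale noise and conditional laws. -/

noncomputable section

namespace LearningGame

variable {ι Θ Ω : Type*} [Fintype ι] {d : ι → ℕ}

theorem norm_diffuse_le [DecidableEq ι] {W : Matrix ι ι ℝ} (hW : W ∈ doublyStochastic ℝ ι)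
    {α : ℕ → ℝ} (hα : ∀ t, 0 ≤ α t) {r : ℕ → ι → ℝ} {K : ℝ} (hr : ∀ t, ‖r t‖ ≤ K) (T : ℕ) :
    ‖diffuse W α r T‖ ≤ K * clock α T := by
  induction T with
  | zero => simp [diffuse, clock]
  | succ t ih =>
    rw [diffuse, clock_succ]
    refine (norm_mulVec_le hW _).trans ((norm_add_le _ _).trans ?_)
    rw [norm_smul, Real.norm_of_nonneg (hα t)]
    nlinarith [mul_le_mul_of_nonneg_left (hr t) (hα t)]

/-- Bounded martingale differences with square summable weights accumulate to bounded sums over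
the network, almost surely. -/
theorem ae_bounded_diffuse [DecidableEq ι] {m0 : MeasurableSpace Ω} {P : Measure Ω}
    [IsProbabilityMeasure P] {ℱ : Filtration ℕ m0} {W : Matrix ι ι ℝ}
    (hW : W ∈ doublyStochastic ℝ ι) {α : ℕ → ℝ} (hα : IsStepSize α) {ξ : ℕ → Ω → ι → ℝ} {K : ℝ}
    (hK : ∀ t ω, ‖ξ t ω‖ ≤ K) (hm : ∀ t, Measurable[ℱ (t + 1)] (ξ t))
    (hξ : ∀ t i, P[fun ω => ξ t ω i | ℱ t] =ᵐ[P] 0) :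
    ∀ᵐ ω ∂P, ∃ B, ∀ t i, |diffuse W α (fun s => ξ s ω) t i| ≤ B := by
  have hα0 := fun t => (hα.mem_Ioo t).1.le
  set n : ℕ → Ω → ι → ℝ := fun t ω => diffuse W α (fun s => ξ s ω) t with hn
  have hnm : ∀ t, Measurable[ℱ t] (n t) := by
    intro t
    induction t with
    | zero => exact measurable_const
    | succ t ih =>
      have h1 : Measurable[ℱ (t + 1)] fun ω => n t ω + α t • ξ t ω :=
        (ih.mono (ℱ.mono (Nat.le_succ t)) le_rfl).add ((hm t).const_smul (α t))
      exact (Continuous.matrix_mulVec continuous_const continuous_id).measurable.comp h1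
  have hnb : ∀ t ω i, |n t ω i| ≤ K * clock α t := fun t ω i =>
    (norm_le_pi_norm (n t ω) i).trans (norm_diffuse_le hW hα0 (fun s => hK s ω) t)
  have hξb : ∀ t ω i, |ξ t ω i| ≤ K := fun t ω i => (norm_le_pi_norm (ξ t ω) i).trans (hK t ω)
  have hnmi : ∀ t i, Measurable[ℱ t] fun ω => n t ω i := fun t i =>
    (measurable_pi_apply i).comp (hnm t)
  have hξmi : ∀ t i, Measurable[ℱ (t + 1)] fun ω => ξ t ω i := fun t i =>
    (measurable_pi_apply i).comp (hm t)
  have hξint : ∀ t i, Integrable (fun ω => ξ t ω i) P := fun t i =>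
    Integrable.of_bound ((hξmi t i).mono (ℱ.le _) le_rfl).aestronglyMeasurable K
      (Eventually.of_forall fun ω => hξb t ω i)
  set Q : ℕ → Ω → ℝ := fun t ω => ∑ i, n t ω i ^ 2 with hQ
  have hQ0 : ∀ t ω, 0 ≤ Q t ω := fun t ω => Finset.sum_nonneg fun i _ => sq_nonneg _
  have hQm : ∀ t, Measurable[ℱ t] (Q t) := fun t =>
    Finset.measurable_sum _ fun i _ => (hnmi t i).pow_const 2
  have hQint : ∀ t, Integrable (Q t) P := by
    intro t
    refine Integrable.of_bound ((hQm t).mono (ℱ.le _) le_rfl).aestronglyMeasurable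
      (∑ _i : ι, (K * clock α t) ^ 2) (Eventually.of_forall fun ω => ?_)
    rw [Real.norm_of_nonneg (hQ0 t ω)]
    exact Finset.sum_le_sum fun i _ => sq_le_sq' (abs_le.1 (hnb t ω i)).1 (abs_le.1 (hnb t ω i)).2
  set A : ℝ := Fintype.card ι * K ^ 2 with hA
  have hA0 : 0 ≤ A := by positivity
  set σ : ℕ → ℝ := clock fun t => α t ^ 2 with hσ
  set D : ℕ → Ω → ℝ := fun t ω => ∑ i, n t ω i * ξ t ω i with hD
  have hDi : ∀ t i, Integrable ((fun ω => n t ω i) * fun ω => ξ t ω i) P := fun t i =>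
    (hξint t i).bdd_mul (c := K * clock α t)
      ((hnmi t i).mono (ℱ.le _) le_rfl).aestronglyMeasurable
      (Eventually.of_forall fun ω => hnb t ω i)
  have hDeq : ∀ t, D t = ∑ i, (fun ω => n t ω i) * fun ω => ξ t ω i := by
    intro t; ext ω; simp [hD]
  have hDint : ∀ t, Integrable (D t) P := by
    intro t
    rw [hDeq]
    exact integrable_finsetSum' _ fun i _ => hDi t i
  have hD0 : ∀ t, P[D t | ℱ t] =ᵐ[P] 0 := by
    intro t
    have h1 : ∀ i, P[(fun ω => n t ω i) * (fun ω => ξ t ω i) | ℱ t] =ᵐ[P] 0 := by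
      intro i
      filter_upwards [condExp_mul_of_stronglyMeasurable_left (hnmi t i).stronglyMeasurable
        (hDi t i) (hξint t i), hξ t i] with ω h1 h2
      rw [h1, Pi.mul_apply, h2]; simp
    rw [hDeq]
    filter_upwards [condExp_finsetSum (s := Finset.univ) (fun i _ => hDi t i) (ℱ t),
      eventually_countable_forall.2 h1] with ω h2 h3
    rw [h2, Finset.sum_apply]
    exact Finset.sum_eq_zero fun i _ => h3 i
  -- Mixing does not increase `Q`. Expanding the square leaves a cross term of zero conditional mean
  -- and a term of at most `A * α t ^ 2`, which makes `A * σ - Q` a submartingale.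
  have hstep : ∀ t ω, A * σ t - Q t ω + (-(2 * α t)) * D t ω ≤ A * σ (t + 1) - Q (t + 1) ω := by
    intro t ω
    have h1 : Q (t + 1) ω ≤ ∑ i, (n t ω i + α t * ξ t ω i) ^ 2 := by
      have := sum_sq_mulVec_le hW (n t ω + α t • ξ t ω)
      simpa [hQ, hn, diffuse] using this
    have h2 : ∑ i, (n t ω i + α t * ξ t ω i) ^ 2 =
        Q t ω + 2 * α t * D t ω + α t ^ 2 * ∑ i, ξ t ω i ^ 2 := by
      simp only [hQ, hD, Finset.mul_sum, ← Finset.sum_add_distrib]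
      exact Finset.sum_congr rfl fun i _ => by ring
    have h3 : ∑ i, ξ t ω i ^ 2 ≤ A := by
      calc ∑ i, ξ t ω i ^ 2 ≤ ∑ _i : ι, K ^ 2 := Finset.sum_le_sum fun i _ =>
            sq_le_sq' (abs_le.1 (hξb t ω i)).1 (abs_le.1 (hξb t ω i)).2
        _ = A := by simp [hA]
    have h4 := mul_le_mul_of_nonneg_left h3 (sq_nonneg (α t))
    have h5 : σ (t + 1) = σ t + α t ^ 2 := clock_succ _ _
    rw [h5]
    linarith
  set M : ℕ → Ω → ℝ := fun t ω => A * σ t - Q t ω with hMdef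
  have hMm : ∀ t, Measurable[ℱ t] (M t) := fun t => measurable_const.sub (hQm t)
  have hMint : ∀ t, Integrable (M t) P := fun t => (integrable_const _).sub (hQint t)
  have hsub : Submartingale M ℱ P := by
    refine submartingale_nat (fun t => (hMm t).stronglyMeasurable) hMint fun t => ?_
    have h1 : P[M t + (-(2 * α t)) • D t | ℱ t] ≤ᵐ[P] P[M (t + 1) | ℱ t] :=
      condExp_mono ((hMint t).add ((hDint t).smul _)) (hMint (t + 1))
        (Eventually.of_forall fun ω => hstep t ω)
    filter_upwards [h1, condExp_add (hMint t) ((hDint t).smul (-(2 * α t))) (ℱ t),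
      condExp_smul (μ := P) (-(2 * α t)) (D t) (ℱ t), hD0 t] with ω h1 h2 h3 h4
    rw [h2, Pi.add_apply, h3, Pi.smul_apply, h4,
      condExp_of_stronglyMeasurable (ℱ.le t) (hMm t).stronglyMeasurable (hMint t)] at h1
    simpa using h1
  have hσle : ∀ t, σ t ≤ ∑' s, α s ^ 2 := fun t =>
    hα.sq_summable.sum_le_tsum _ fun s _ => sq_nonneg _
  set R : ℝ := 2 * A * ∑' s, α s ^ 2 with hR
  -- Here `|M t| ≤ 2 * A * σ t - M t`, and `M t` has nonnegative mean since `M 0 = 0`.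
  have hL1 : ∀ t, eLpNorm (M t) 1 P ≤ (R.toNNReal : ENNReal) := by
    intro t
    rw [eLpNorm_one_eq_lintegral_enorm, ← ofReal_integral_norm_eq_lintegral_enorm (hMint t)]
    refine ENNReal.ofReal_le_ofReal ?_
    have h0 : 0 ≤ ∫ ω, M t ω ∂P := by
      have := hsub.setIntegral_le (Nat.zero_le t) (MeasurableSet.univ)
      simpa [hMdef, hσ, clock, hQ, hn, diffuse] using this
    have hσ0 : 0 ≤ σ t := Finset.sum_nonneg fun s _ => sq_nonneg _
    calc ∫ ω, ‖M t ω‖ ∂P ≤ ∫ ω, (2 * A * σ t - M t ω) ∂P := by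
          refine integral_mono (hMint t).norm ((integrable_const _).sub (hMint t)) fun ω => ?_
          have h1 := hQ0 t ω
          have h2 := mul_nonneg hA0 hσ0
          simp only [hMdef]
          exact abs_le.2 ⟨by linarith, by linarith⟩
      _ = 2 * A * σ t - ∫ ω, M t ω ∂P := by
          rw [integral_sub (integrable_const _) (hMint t)]; simp
      _ ≤ R := by
          have := mul_le_mul_of_nonneg_left (hσle t) hA0
          linarith
  -- Of the convergence only boundedness is kept: a lower bound for `M` is an upper bound for `Q`.
  filter_upwards [hsub.exists_ae_tendsto_of_bdd hL1] with ω hω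
  obtain ⟨c, hc⟩ := hω
  obtain ⟨B, hB⟩ := hc.bddBelow_range
  refine ⟨A * ∑' s, α s ^ 2 - B + 1, fun t i => ?_⟩
  have h1 : B ≤ M t ω := hB ⟨t, rfl⟩
  have h2 : n t ω i ^ 2 ≤ Q t ω :=
    Finset.single_le_sum (f := fun i => n t ω i ^ 2) (fun i _ => sq_nonneg _) (Finset.mem_univ i)
  have h3 := mul_le_mul_of_nonneg_left (hσle t) hA0
  have h4 : |n t ω i| ≤ n t ω i ^ 2 + 1 := by
    rw [← sq_abs]; nlinarith [sq_nonneg (|n t ω i| - 1)]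
  simp only [hMdef] at h1
  linarith

namespace Game

variable {G : Game ι Θ d}

/-- A Carathéodory function, continuous in the profile and measurable in the cost, is jointly
measurable. -/
theorem IsModel.measurable_uncurry_f (hG : G.IsModel) (h1 : G.BoundedInformation) (j : ι) (θ : Θ) :
    Measurable (Function.uncurry fun (p : G.profiles) (y : ℝ) => G.f j y p θ) :=
  measurable_uncurry_of_continuous_of_measurable
    (fun y => continuousOn_iff_continuous_domRestrict.1 (h1.continuous j y θ))
    fun p => hG.f_measurable j p p.2 θ

theorem IsModel.exists_kernel (hG : G.IsModel) (h1 : G.BoundedInformation) (j : ι) (θ : Θ) :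
    ∃ κ : Kernel G.profiles ℝ, IsMarkovKernel κ ∧ ∀ p, κ p = G.law j p θ := by
  have := hG.sigmaFinite_ref j
  have hm : Measurable (Function.uncurry fun (p : G.profiles) (y : ℝ) =>
    ENNReal.ofReal (G.f j y p θ)) := (hG.measurable_uncurry_f h1 j θ).ennreal_ofReal
  have hκ : ∀ p, (Kernel.const G.profiles (G.ref j)).withDensity
      (fun p y => ENNReal.ofReal (G.f j y p θ)) p = G.law j p θ := fun p => by
    rw [Kernel.withDensity_apply _ hm, Kernel.const_apply, law]
  exact ⟨_, ⟨fun p => by rw [hκ]; exact hG.law_prob j p p.2 θ⟩, hκ⟩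

/-- The minimum over the compact set of profiles is attained, and there the identifying agent
contributes a positive term. Uniformity in the profile is what frees learning from the behaviour of
the strategies. -/
theorem Identifiable.exists_average_info_ge [Nonempty ι] {θs θ : Θ}
    (h2 : G.Identifiable θs) (hG : G.IsModel) (h1 : G.BoundedInformation) (hθ : θ ≠ θs)
    (hne : G.profiles.Nonempty) :
    ∃ c > 0, ∀ p ∈ G.profiles, c ≤ average fun j => G.info θs θ j p := by
  have hc : ContinuousOn (fun p => average fun j => G.info θs θ j p) G.profiles :=
    (continuousOn_finsetSum _ fun j _ => hG.continuousOn_info h1).div_const _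
  obtain ⟨p₀, hp₀, hmin⟩ := hG.isCompact_profiles.exists_isMinOn hne hc
  refine ⟨_, ?_, fun p hp => hmin hp⟩
  obtain ⟨i, hi⟩ := h2 θ hθ
  have hi' := hi p₀ hp₀
  rw [(h1.klDiv_eq hG hp₀).2, ENNReal.ofReal_pos] at hi'
  exact div_pos (Finset.sum_pos' (fun j _ => (h1.klDiv_eq hG hp₀).1) ⟨i, Finset.mem_univ i, hi'⟩)
    (by exact_mod_cast Fintype.card_pos)

theorem BoundedInformation.networkDivergence_eq [Nonempty ι] {θs θ : Θ} {p : Profile d}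
    (h1 : G.BoundedInformation) (hG : G.IsModel) (hp : p ∈ G.profiles) :
    G.networkDivergence p θs θ = ENNReal.ofReal (average fun j => G.info θs θ j p) := by
  have hN : (0 : ℝ) < Fintype.card ι := by exact_mod_cast Fintype.card_pos
  rw [networkDivergence, average, ENNReal.ofReal_div_of_pos hN, ENNReal.ofReal_natCast,
    ENNReal.ofReal_sum_of_nonneg fun j _ => (h1.klDiv_eq hG hp).1]
  congr 1
  exact Finset.sum_congr rfl fun j _ => (h1.klDiv_eq hG hp).2

end Game

theorem measurable_profile_history {ι Ω : Type*} {d : ι → ℕ} {x : ℕ → Ω → Profile d}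
    {y : ℕ → Ω → ι → ℝ} {s t : ℕ} (h : s ≤ t) : Measurable[history x y t] (x s) :=
  Measurable.of_comap_le ((le_iSup₂_of_le (f := fun s (_ : s ∈ Set.Iic t) =>
    MeasurableSpace.comap (x s) inferInstance) s h le_rfl).trans le_sup_left)

theorem measurable_cost_history {ι Ω : Type*} {d : ι → ℕ} {x : ℕ → Ω → Profile d}
    {y : ℕ → Ω → ι → ℝ} {s t : ℕ} (h : s < t) : Measurable[history x y t] (y s) :=
  Measurable.of_comap_le ((le_iSup₂_of_le (f := fun s (_ : s ∈ Set.Iio t) =>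
    MeasurableSpace.comap (y s) inferInstance) s h le_rfl).trans le_sup_right)

section Run

variable [DecidableEq ι] [Fintype Θ] [mΩ : MeasurableSpace Ω] {P : Measure Ω} {G : Game ι Θ d}
  {W : Matrix ι ι ℝ} {α : ℕ → ℝ} {θs : Θ} {x : ℕ → Ω → Profile d} {y : ℕ → Ω → ι → ℝ}

theorem IsRun.mem_profiles (h : IsRun P G W α θs x y) (hG : G.IsModel) (hα : IsStepSize α)
    (t : ℕ) (ω : Ω) : x t ω ∈ G.profiles := by
  induction t with
  | zero => exact h.init_mem ω
  | succ t ih =>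
    intro i
    obtain ⟨z, hz, hx⟩ := h.strategy_update ω t i
    obtain ⟨h0, h1⟩ := hα.mem_Ioo t
    rw [hx]
    exact hG.convex_strat i (ih i) hz.1 (by linarith) h0.le (by ring)

/-- The filtration of the past. -/
def IsRun.filtration (h : IsRun P G W α θs x y) : Filtration ℕ mΩ where
  seq := history x y
  mono' _ _ hst := sup_le_sup
    (biSup_mono fun _ hk => le_trans (Set.mem_Iic.1 hk) hst)
    (biSup_mono fun _ hk => lt_of_lt_of_le (Set.mem_Iio.1 hk) hst)
  le' _ := sup_le (iSup₂_le fun s _ => (h.measurable_x s).comap_le)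
    (iSup₂_le fun s _ => (h.measurable_y s).comap_le)

/-- The profile of period `t` as a random element of the set of profiles. -/
def IsRun.profile (h : IsRun P G W α θs x y) (hG : G.IsModel) (hα : IsStepSize α) (t : ℕ)
    (ω : Ω) : G.profiles := ⟨x t ω, h.mem_profiles hG hα t ω⟩

theorem IsRun.measurable_profile (h : IsRun P G W α θs x y) (hG : G.IsModel)
    (hα : IsStepSize α) {s t : ℕ} (hst : s ≤ t) :
    Measurable[history x y t] (h.profile hG hα s) :=
  (measurable_profile_history hst).subtype_mk

variable [IsProbabilityMeasure P]

theorem IsRun.setIntegral_law (h : IsRun P G W α θs x y) (hG : G.IsModel)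
    (hα : IsStepSize α) {t : ℕ} {A : Set Ω} (hA : MeasurableSet[history x y t] A) (j : ι)
    {B : Set ℝ} (hB : MeasurableSet B) :
    P (A ∩ {ω | y t ω j ∈ B}) = ∫⁻ ω in A, G.law j (x t ω) θs B ∂P := by
  have hle : history x y t ≤ mΩ := h.filtration.le t
  have hprob : ∀ i ω, IsProbabilityMeasure (G.law i (x t ω) θs) := fun i ω =>
    hG.law_prob i _ (h.mem_profiles hG hα t ω) θs
  have hset : {ω | ∀ i, y t ω i ∈ Function.update (fun _ => Set.univ) j B i} =
      {ω | y t ω j ∈ B} := by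
    ext ω
    constructor
    · intro hω; simpa using hω j
    · intro hω i
      rcases eq_or_ne i j with rfl | hij
      · simpa using hω
      · simp [hij]
  have hyB : MeasurableSet {ω | y t ω j ∈ B} :=
    ((measurable_pi_apply j).comp (h.measurable_y t)) hB
  have hc := h.cond_law t (Function.update (fun _ => Set.univ) j B) fun i => by
    rcases eq_or_ne i j with rfl | hij
    · simpa using hB
    · simp [hij]
  rw [hset] at hc
  have hprod : ∀ ω, ∏ i, (G.law i (x t ω) θs).real (Function.update (fun _ => Set.univ) j B i) =
      (G.law j (x t ω) θs).real B := by
    intro ω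
    rw [Finset.prod_eq_single j]
    · simp
    · intro i _ hij
      have := hprob i ω
      simp [hij]
    · simp
  simp only [hprod] at hc
  have hint : Integrable ({ω | y t ω j ∈ B}.indicator fun _ => (1 : ℝ)) P :=
    (integrable_const _).indicator hyB
  have h1 := setIntegral_condExp hle hint hA
  rw [setIntegral_congr_ae (hle _ hA) (hc.mono fun ω hω _ => hω)] at h1
  have h2 : ∫ ω in A, {ω | y t ω j ∈ B}.indicator (fun _ => (1 : ℝ)) ω ∂P =
      P.real (A ∩ {ω | y t ω j ∈ B}) := by
    rw [setIntegral_indicator hyB]; simp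
  have hlint : Integrable (fun ω => (G.law j (x t ω) θs).real B) P :=
    integrable_condExp.congr hc
  rw [h2] at h1
  have h3 := congrArg ENNReal.ofReal h1
  rw [ofReal_integral_eq_lintegral_ofReal hlint.integrableOn
    (Eventually.of_forall fun ω => measureReal_nonneg), ofReal_measureReal] at h3
  rw [← h3]
  refine lintegral_congr fun ω => ?_
  have := hprob j ω
  rw [ofReal_measureReal]

/-- Rectangles determine the joint law. Restriction to an arbitrary past event `A` carries the
conditioning. -/
theorem IsRun.map_restrict_eq_compProd (h : IsRun P G W α θs x y) (hG : G.IsModel)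
    (hα : IsStepSize α) {t : ℕ} {A : Set Ω}
    (hA : MeasurableSet[history x y t] A) (j : ι) {κ : Kernel G.profiles ℝ} [IsMarkovKernel κ]
    (hκ : ∀ p, κ p = G.law j p θs) :
    (P.restrict A).map (fun ω => (h.profile hG hα t ω, y t ω j)) =
      (P.restrict A).map (h.profile hG hα t) ⊗ₘ κ := by
  have hle : history x y t ≤ mΩ := h.filtration.le t
  have hp : Measurable (h.profile hG hα t) := (h.measurable_profile hG hα le_rfl).mono hle le_rfl
  have hy : Measurable fun ω => y t ω j := (measurable_pi_apply j).comp (h.measurable_y t)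
  refine Measure.ext_prod fun {C B} hC hB => ?_
  have hAC : MeasurableSet[history x y t] (h.profile hG hα t ⁻¹' C ∩ A) :=
    (h.measurable_profile hG hα le_rfl hC).inter hA
  rw [Measure.map_apply (hp.prodMk hy) (hC.prod hB), Measure.compProd_apply_prod hC hB,
    setLIntegral_map hC (κ.measurable_coe hB) hp,
    Measure.restrict_apply ((hp.prodMk hy) (hC.prod hB)),
    Measure.restrict_restrict (hp hC)]
  have h1 := h.setIntegral_law hG hα hAC j hB
  simp only [hκ]
  refine Eq.trans ?_ h1
  congr 1
  ext ω
  simp only [Set.mem_inter_iff, Set.mem_preimage, Set.mem_prod, Set.mem_ofPred_eq]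
  tauto

/-- Conditional means, given the past, of functions of the current profile and cost. -/
theorem IsRun.condExp_eq (h : IsRun P G W α θs x y) (hG : G.IsModel)
    (hα : IsStepSize α) (h1 : G.BoundedInformation) (t : ℕ) (j : ι) {ρ : G.profiles × ℝ → ℝ}
    (hρ : Measurable ρ) {L : ℝ} (hL : ∀ q, |ρ q| ≤ L) :
    P[fun ω => ρ (h.profile hG hα t ω, y t ω j) | history x y t] =ᵐ[P]
      fun ω => ∫ v, ρ (h.profile hG hα t ω, v) ∂(G.law j (x t ω) θs) := by
  have hle : history x y t ≤ mΩ := h.filtration.le t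
  obtain ⟨κ, hκm, hκ⟩ := hG.exists_kernel h1 j θs
  have hp' := h.measurable_profile hG hα (le_refl t)
  have hp : Measurable (h.profile hG hα t) := hp'.mono hle le_rfl
  have hy : Measurable fun ω => y t ω j := (measurable_pi_apply j).comp (h.measurable_y t)
  have hg : StronglyMeasurable fun p : G.profiles => ∫ v, ρ (p, v) ∂(κ p) :=
    hρ.stronglyMeasurable.integral_kernel_prod_right'
  have heq : (fun ω => ∫ v, ρ (h.profile hG hα t ω, v) ∂(G.law j (x t ω) θs)) =
      fun ω => ∫ v, ρ (h.profile hG hα t ω, v) ∂(κ (h.profile hG hα t ω)) := by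
    ext ω; rw [hκ]; rfl
  rw [heq]
  have hgm : StronglyMeasurable[history x y t]
      fun ω => ∫ v, ρ (h.profile hG hα t ω, v) ∂(κ (h.profile hG hα t ω)) :=
    hg.comp_measurable hp'
  have hgi : Integrable
      (fun ω => ∫ v, ρ (h.profile hG hα t ω, v) ∂(κ (h.profile hG hα t ω))) P := by
    refine Integrable.of_bound (hgm.mono hle).aestronglyMeasurable L
      (Eventually.of_forall fun ω => ?_)
    simpa using norm_integral_le_of_norm_le_const (μ := κ (h.profile hG hα t ω))
      (f := fun v => ρ (h.profile hG hα t ω, v)) (C := L) (Eventually.of_forall fun v => hL (h.profile hG hα t ω, v))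
  refine (ae_eq_condExp_of_forall_setIntegral_eq hle ?_ (fun s _ _ => hgi.integrableOn) ?_
    hgm.aestronglyMeasurable).symm
  · exact Integrable.of_bound (hρ.comp (hp.prodMk hy)).aestronglyMeasurable L
      (Eventually.of_forall fun ω => hL _)
  · intro A hA _
    have h2 := h.map_restrict_eq_compProd hG hα hA j hκ
    have h3 : ∫ ω in A, ρ (h.profile hG hα t ω, y t ω j) ∂P =
        ∫ q, ρ q ∂((P.restrict A).map fun ω => (h.profile hG hα t ω, y t ω j)) :=
      (integral_map (hp.prodMk hy).aemeasurable hρ.aestronglyMeasurable).symm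
    rw [h3, h2, Measure.integral_compProd, integral_map hp.aemeasurable hg.aestronglyMeasurable]
    exact Integrable.of_bound hρ.aestronglyMeasurable L (Eventually.of_forall hL)

/-- Almost surely all realized costs have positive likelihood. -/
theorem IsRun.ae_likelihood_pos (h : IsRun P G W α θs x y) (hG : G.IsModel)
    (hα : IsStepSize α) (h1 : G.BoundedInformation) :
    ∀ᵐ ω ∂P, ∀ t j θ, 0 < G.f j (y t ω j) (x t ω) θ := by
  have key : ∀ t j, ∀ᵐ ω ∂P, G.f j (y t ω j) (x t ω) θs ≠ 0 := by
    intro t j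
    obtain ⟨κ, hκm, hκ⟩ := hG.exists_kernel h1 j θs
    have hle : history x y t ≤ mΩ := h.filtration.le t
    have hp : Measurable (h.profile hG hα t) := (h.measurable_profile hG hα le_rfl).mono hle le_rfl
    have hy : Measurable fun ω => y t ω j := (measurable_pi_apply j).comp (h.measurable_y t)
    have hS : MeasurableSet {q : G.profiles × ℝ | G.f j q.2 q.1 θs = 0} :=
      hG.measurable_uncurry_f h1 j θs (measurableSet_singleton 0)
    have h2 := h.map_restrict_eq_compProd hG hα (t := t) (A := Set.univ)
      (@MeasurableSet.univ _ (history x y t)) j hκ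
    rw [Measure.restrict_univ] at h2
    have h3 := congrArg (fun μ => μ {q : G.profiles × ℝ | G.f j q.2 q.1 θs = 0}) h2
    rw [Measure.map_apply (hp.prodMk hy) hS, Measure.compProd_apply hS] at h3
    -- The density vanishes on this section, which therefore has mass zero.
    have h4 : ∀ p : G.profiles, κ p (Prod.mk p ⁻¹' {q : G.profiles × ℝ | G.f j q.2 q.1 θs = 0}) =
        0 := by
      intro p
      rw [hκ, Game.law, withDensity_apply _ (measurable_prodMk_left hS)]
      refine (setLIntegral_congr_fun (measurable_prodMk_left hS) (g := fun _ => 0)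
        fun v hv => ?_).trans (by simp)
      have : G.f j v p θs = 0 := hv
      simp [this]
    simp only [h4, lintegral_zero] at h3
    exact (measure_eq_zero_iff_ae_notMem.1 h3)
  filter_upwards [ae_all_iff.2 fun t => ae_all_iff.2 fun j => key t j] with ω hω t j θ
  have hx := h.mem_profiles hG hα t ω
  refine lt_of_le_of_ne (hG.f_nonneg j _ _ hx θ) fun h0 => hω t j ?_
  exact h1.common_support j _ _ hx θs θ h0.symm

/-- The noise in the accumulated log-likelihood ratios stays bounded. -/
theorem IsRun.ae_bounded_noise (h : IsRun P G W α θs x y) (hG : G.IsModel)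
    (hα : IsStepSize α) (h1 : G.BoundedInformation)
    (hW : W ∈ doublyStochastic ℝ ι) (θ : Θ) :
    ∀ᵐ ω ∂P, ∃ B, ∀ t i, |diffuse W α (fun s j => G.logRatio θs θ j (x s ω) (y s ω j) -
      G.info θs θ j (x s ω)) t i| ≤ B := by
  obtain ⟨L, hL0, hL⟩ := h1.bounded
  set ρ : ι → G.profiles × ℝ → ℝ := fun j q => G.logRatio θs θ j q.1 q.2 with hρdef
  have hρ : ∀ j, Measurable (ρ j) := fun j =>
    ((hG.measurable_uncurry_f h1 j θs).div (hG.measurable_uncurry_f h1 j θ)).log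
  have hρL : ∀ j q, |ρ j q| ≤ L := fun j q => hL j θs θ q.1 q.1.2 q.2
  have hinfo : ∀ t ω j, ∫ v, ρ j (h.profile hG hα t ω, v) ∂(G.law j (x t ω) θs) =
      G.info θs θ j (x t ω) := fun t ω j => hG.integral_law (h.mem_profiles hG hα t ω) _
  have hinfoL : ∀ t ω j, |G.info θs θ j (x t ω)| ≤ L := by
    intro t ω j
    have := hG.law_prob j _ (h.mem_profiles hG hα t ω) θs
    rw [← hinfo]
    simpa using norm_integral_le_of_norm_le_const (μ := G.law j (x t ω) θs)
      (f := fun v => ρ j (h.profile hG hα t ω, v)) (C := L) (Eventually.of_forall fun v => hρL j (h.profile hG hα t ω, v))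
  have hinfom : ∀ t j, Measurable[history x y t] fun ω => G.info θs θ j (x t ω) := by
    intro t j
    have h2 : Measurable fun p : G.profiles => G.info θs θ j p :=
      (continuousOn_iff_continuous_domRestrict.1
        (hG.continuousOn_info h1 (θs := θs) (θ := θ) (j := j))).measurable
    exact h2.comp (h.measurable_profile hG hα le_rfl)
  have hρm : ∀ t j, Measurable[history x y (t + 1)]
      fun ω => ρ j (h.profile hG hα t ω, y t ω j) := fun t j =>
    (hρ j).comp ((h.measurable_profile hG hα (Nat.le_succ t)).prodMk
      ((measurable_pi_apply j).comp (measurable_cost_history (Nat.lt_succ_self t))))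
  refine ae_bounded_diffuse (ℱ := h.filtration) (K := 2 * L) hW hα
    (ξ := fun s ω j => G.logRatio θs θ j (x s ω) (y s ω j) - G.info θs θ j (x s ω)) ?_ ?_ ?_
  · intro t ω
    refine (pi_norm_le_iff_of_nonneg (by linarith)).2 fun j => ?_
    refine (norm_sub_le _ _).trans ?_
    have h2 := hρL j (h.profile hG hα t ω, y t ω j)
    have h3 := hinfoL t ω j
    simp only [Real.norm_eq_abs]
    have : |G.logRatio θs θ j (x t ω) (y t ω j)| ≤ L := h2
    linarith
  · intro t
    refine @measurable_pi_lambda Ω ι _ (history x y (t + 1)) _ _ fun j => ?_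
    exact (hρm t j).sub ((hinfom t j).mono (h.filtration.mono (Nat.le_succ t)) le_rfl)
  · intro t j
    have hle : history x y t ≤ mΩ := h.filtration.le t
    have i1 : Integrable (fun ω => ρ j (h.profile hG hα t ω, y t ω j)) P :=
      Integrable.of_bound ((hρm t j).mono (h.filtration.le _) le_rfl).aestronglyMeasurable L
        (Eventually.of_forall fun ω => hρL j _)
    have i2 : Integrable (fun ω => G.info θs θ j (x t ω)) P :=
      Integrable.of_bound ((hinfom t j).mono hle le_rfl).aestronglyMeasurable L
        (Eventually.of_forall fun ω => hinfoL t ω j)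
    filter_upwards [condExp_sub i1 i2 (history x y t), h.condExp_eq hG hα h1 t j (hρ j) (hρL j)]
      with ω h2 h3
    have h4 : P[fun ω => G.info θs θ j (x t ω) | history x y t] =
        fun ω => G.info θs θ j (x t ω) :=
      condExp_of_stronglyMeasurable hle (hinfom t j).stronglyMeasurable i2
    rw [Pi.sub_apply, h3, h4, hinfo, sub_self] at h2
    exact h2

end Run

end LearningGame

end

/-! ### Beliefs through their log-odds. -/

noncomputable section

namespace LearningGame

variable {ι Θ : Type*} [Fintype ι] [Fintype Θ] {d : ι → ℕ}

theorem pool_pos [Nonempty Θ] (w : ι → ℝ) (b : ι → Θ → ℝ) (θ : Θ) : 0 < pool w b θ :=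
  div_pos (Real.exp_pos _) (Finset.sum_pos (fun _ _ => Real.exp_pos _) Finset.univ_nonempty)

theorem sum_pool [Nonempty Θ] (w : ι → ℝ) (b : ι → Θ → ℝ) : ∑ θ, pool w b θ = 1 := by
  unfold pool
  rw [← Finset.sum_div, div_self]
  exact (Finset.sum_pos (fun _ _ => Real.exp_pos _) Finset.univ_nonempty).ne'

theorem log_pool_div_pool [Nonempty Θ] (w : ι → ℝ) (b : ι → Θ → ℝ) (θ θ' : Θ) :
    Real.log (pool w b θ / pool w b θ') =
      ∑ j, w j * (Real.log (b j θ) - Real.log (b j θ')) := by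
  have h : (∑ θ', Real.exp (∑ j, w j * Real.log (b j θ'))) ≠ 0 :=
    (Finset.sum_pos (fun _ _ => Real.exp_pos _) Finset.univ_nonempty).ne'
  unfold pool
  rw [div_div_div_cancel_right₀ h, ← Real.exp_sub, Real.log_exp, ← Finset.sum_sub_distrib]
  exact Finset.sum_congr rfl fun j _ => by ring

theorem log_posterior_sub [Nonempty Θ] (a : ℝ) {ℓ m : Θ → ℝ} (hℓ : ∀ θ, 0 < ℓ θ)
    (hm : ∀ θ, 0 < m θ) (θ θ' : Θ) :
    Real.log (posterior a ℓ m θ) - Real.log (posterior a ℓ m θ') =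
      Real.log (m θ / m θ') + a * Real.log (ℓ θ / ℓ θ') := by
  have hp : ∀ θ, 0 < ℓ θ ^ a := fun θ => Real.rpow_pos_of_pos (hℓ θ) a
  have hS : (∑ θ', ℓ θ' ^ a * m θ') ≠ 0 :=
    (Finset.sum_pos (fun θ _ => mul_pos (hp θ) (hm θ)) Finset.univ_nonempty).ne'
  unfold posterior
  rw [Real.log_div (mul_pos (hp θ) (hm θ)).ne' hS, Real.log_div (mul_pos (hp θ') (hm θ')).ne' hS,
    Real.log_mul (hp θ).ne' (hm θ).ne', Real.log_mul (hp θ').ne' (hm θ').ne',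
    Real.log_rpow (hℓ θ), Real.log_rpow (hℓ θ'), Real.log_div (hm θ).ne' (hm θ').ne',
    Real.log_div (hℓ θ).ne' (hℓ θ').ne']
  ring

variable {G : Game ι Θ d} {W : Matrix ι ι ℝ} {α : ℕ → ℝ} {x : ℕ → Profile d} {y : ℕ → ι → ℝ}

theorem belief_pos [Nonempty Θ] (t : ℕ) (i : ι) (θ : Θ) : 0 < belief G W α x y t i θ := by
  cases t with
  | zero => simp only [belief]; positivity
  | succ t => exact pool_pos _ _ _

theorem sum_belief [Nonempty Θ] (t : ℕ) (i : ι) : ∑ θ, belief G W α x y t i θ = 1 := by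
  cases t with
  | zero => simp [belief]
  | succ t => exact sum_pool _ _

/-- Geometric pooling is linear averaging of logarithms, and the uniform prior starts the recursion
at zero. Positive likelihoods keep every logarithm meaningful. -/
theorem log_belief_div_belief [Nonempty Θ] (hf : ∀ t j θ, 0 < G.f j (y t j) (x t) θ) (θ θ' : Θ)
    (t : ℕ) (i : ι) :
    Real.log (belief G W α x y t i θ / belief G W α x y t i θ') =
      diffuse W α (fun s j => G.logRatio θ θ' j (x s) (y s j)) t i := by
  induction t generalizing i with
  | zero => simp [belief, diffuse]
  | succ t ih =>
    rw [belief, log_pool_div_pool, diffuse, Matrix.mulVec, dotProduct]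
    refine Finset.sum_congr rfl fun j _ => ?_
    rw [log_posterior_sub _ (hf t j) (belief_pos t j), ih]
    simp [Game.logRatio]

theorem belief_eq_one_div [Nonempty Θ] [DecidableEq Θ] (t : ℕ) (i : ι) (θ : Θ) :
    belief G W α x y t i θ = 1 / (1 + ∑ θ' ∈ Finset.univ.erase θ,
      Real.exp (-Real.log (belief G W α x y t i θ / belief G W α x y t i θ'))) := by
  have hp := belief_pos (G := G) (W := W) (α := α) (x := x) (y := y) t i
  have h1 : ∀ θ', Real.exp (-Real.log (belief G W α x y t i θ / belief G W α x y t i θ')) =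
      belief G W α x y t i θ' / belief G W α x y t i θ := by
    intro θ'
    rw [← Real.log_inv, inv_div, Real.exp_log (div_pos (hp _) (hp _))]
  simp only [h1]
  rw [← Finset.sum_div]
  have h2 := Finset.add_sum_erase Finset.univ (belief G W α x y t i) (Finset.mem_univ θ)
  rw [sum_belief] at h2
  have h3 : ∑ θ' ∈ Finset.univ.erase θ, belief G W α x y t i θ' = 1 - belief G W α x y t i θ := by
    linarith
  have := (hp θ).ne'
  rw [h3]
  field_simp
  ring

/-- If the log-odds of `θs` against every other parameter diverge, then beliefs concentrate at
`θs`. -/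
theorem tendsto_belief_single [Nonempty Θ] [DecidableEq Θ] {i : ι} {θs : Θ}
    (h : ∀ θ, θ ≠ θs → Tendsto (fun t =>
      Real.log (belief G W α x y t i θs / belief G W α x y t i θ)) atTop atTop) :
    Tendsto (fun t => belief G W α x y t i) atTop (𝓝 (Pi.single θs 1)) := by
  have hs : Tendsto (fun t => belief G W α x y t i θs) atTop (𝓝 1) := by
    have h1 : Tendsto (fun t => ∑ θ' ∈ Finset.univ.erase θs, Real.exp
        (-Real.log (belief G W α x y t i θs / belief G W α x y t i θ'))) atTop (𝓝 0) := by
      rw [← Finset.sum_const_zero (s := Finset.univ.erase θs)]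
      exact tendsto_finsetSum _ fun θ hθ => Real.tendsto_exp_neg_atTop_nhds_zero.comp
        (h θ (Finset.ne_of_mem_erase hθ))
    have h2 := (tendsto_const_nhds (x := (1 : ℝ))).div (h1.const_add 1) (by norm_num)
    simp only [add_zero, div_one] at h2
    exact h2.congr fun t => (belief_eq_one_div t i θs).symm
  rw [tendsto_pi_nhds]
  intro θ
  rcases eq_or_ne θ θs with rfl | hne
  · simpa using hs
  · rw [Pi.single_eq_of_ne hne]
    have h3 : Tendsto (fun t => 1 - belief G W α x y t i θs) atTop (𝓝 0) := by
      simpa using hs.const_sub 1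
    refine squeeze_zero (fun t => (belief_pos t i θ).le) (fun t => ?_) h3
    have h4 : belief G W α x y t i θ + belief G W α x y t i θs ≤ 1 := by
      rw [← sum_belief (G := G) (W := W) (α := α) (x := x) (y := y) t i,
        ← Finset.sum_pair hne]
      exact Finset.sum_le_sum_of_subset_of_nonneg (Finset.subset_univ _)
        fun θ' _ _ => (belief_pos t i θ').le
    linarith

/-- The log-odds grow like the accumulated mean information. -/
theorem IsNetwork.tendsto_logOdds_sub [Nonempty ι] [Nonempty Θ] [DecidableEq ι]
    {E : ι → ι → Prop} (h3 : IsNetwork E W) (hα : IsStepSize α) (hG : G.IsModel)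
    (h1 : G.BoundedInformation) (hx : ∀ t, x t ∈ G.profiles)
    (hdx : Tendsto (fun t => x (t + 1) - x t) atTop (𝓝 0))
    (hf : ∀ t j θ, 0 < G.f j (y t j) (x t) θ) {θs θ : Θ} {B : ℝ}
    (hB : ∀ t i, |diffuse W α (fun s j => G.logRatio θs θ j (x s) (y s j) -
      G.info θs θ j (x s)) t i| ≤ B) (i : ι) :
    Tendsto (fun T => Real.log (belief G W α x y T i θs / belief G W α x y T i θ) / clock α T -
      clock (fun t => α t * average fun j => G.info θs θ j (x t)) T / clock α T)
      atTop (𝓝 0) := by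
  have hα0 := fun t => (hα.mem_Ioo t).1.le
  set g : ℕ → ι → ℝ := fun t j => G.info θs θ j (x t) with hg
  set ξ : ℕ → ι → ℝ := fun s j => G.logRatio θs θ j (x s) (y s j) - G.info θs θ j (x s) with hξ
  have hX := hG.isCompact_profiles
  have hvc : ContinuousOn (fun p j => G.info θs θ j p) G.profiles :=
    continuousOn_pi.2 fun j => hG.continuousOn_info h1
  obtain ⟨C, hC⟩ := (hX.image_of_continuousOn hvc).isBounded.exists_norm_le
  have hgC : ∀ t, ‖g t‖ ≤ C := fun t => hC _ ⟨x t, hx t, rfl⟩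
  -- Uniform continuity on the compact set of profiles turns vanishing increments of `x` into
  -- vanishing increments of `g`.
  have hdg : Tendsto (fun t => g (t + 1) - g t) atTop (𝓝 0) := by
    rw [Metric.tendsto_atTop]
    intro ε hε
    obtain ⟨δ, hδ, hu⟩ := Metric.uniformContinuousOn_iff.1
      (hX.uniformContinuousOn_of_continuous hvc) ε hε
    obtain ⟨T, hT⟩ := Metric.tendsto_atTop.1 hdx δ hδ
    refine ⟨T, fun t ht => ?_⟩
    have := hT t ht
    rw [dist_zero_right, ← dist_eq_norm] at this
    rw [dist_zero_right, ← dist_eq_norm]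
    exact hu _ (hx _) _ (hx _) this
  have hmean := h3.tendsto_diffuse_sub_average hα hgC hdg i
  have hnoise : Tendsto (fun T => diffuse W α ξ T i / clock α T) atTop (𝓝 0) := by
    refine squeeze_zero_norm (fun T => ?_)
      ((hα.sum_eq_top : Tendsto (clock α) atTop atTop).const_div_atTop B)
    have h0 : 0 ≤ clock α T := Finset.sum_nonneg fun t _ => hα0 t
    rw [norm_div, Real.norm_of_nonneg h0]
    exact div_le_div_of_nonneg_right (hB T i) h0
  have hsum := hmean.add hnoise
  rw [add_zero] at hsum
  refine hsum.congr fun T => ?_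
  have hsplit : (fun s j => G.logRatio θs θ j (x s) (y s j)) = g + ξ := by
    ext s j; simp [hg, hξ]
  rw [log_belief_div_belief hf, hsplit, diffuse_add, average_diffuse h3.doublyStochastic,
    Pi.add_apply]
  simp only [clock]
  ring

/-- Time averages along the best-response iteration under asymptotically correct beliefs. -/
theorem Game.ConvexCosts.tendsto_time_average [DecidableEq ι] [DecidableEq Θ] {θs : Θ}
    (h5 : G.ConvexCosts) (hG : G.IsModel) (hα : IsStepSize α) (hx : ∀ t, x t ∈ G.profiles)
    {m : ℕ → ι → Θ → ℝ} (hm : ∀ i, Tendsto (fun t => m t i) atTop (𝓝 (Pi.single θs 1)))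
    (hupd : ∀ t i, ∃ z ∈ G.bestResponse i (x t) (m t i),
      x (t + 1) i = (1 - α t) • x t i + α t • z) {xs : Profile d} (hxs : xs ∈ G.profiles)
    (hsol : ∀ xbar, G.IsBRSolution (Pi.single θs 1) xbar → Tendsto xbar atTop (𝓝 xs))
    {g : Profile d → ℝ} (hg : ContinuousOn g G.profiles) :
    Tendsto (fun T => clock (fun t => α t * g (x t)) T / clock α T) atTop (𝓝 (g xs)) := by
  choose z hz hxz using hupd
  -- A total selection of best responses; its value outside the profiles is arbitrary.
  have hF : ∀ p : Profile d, ∃ q : Profile d, p ∈ G.profiles →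
      ∀ i, q i ∈ G.bestResponse i p (Pi.single θs 1) := by
    intro p
    by_cases hp : p ∈ G.profiles
    · choose q hq using fun i => hG.exists_bestResponse (θs := θs) h5 hp i
      exact ⟨q, fun _ => hq⟩
    · exact ⟨p, fun h => absurd h hp⟩
  choose F hF using hF
  refine LearningGame.tendsto_time_average (z := z) (F := F) hα hG.isCompact_profiles hx
    (fun t i => (hz t i).1) (fun t => ?_) (fun p hp => ?_) hxs (fun φ hφ => hsol φ ?_) hg
  · ext1 i
    rw [hxz, Pi.add_apply, Pi.smul_apply, Pi.sub_apply]
    module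
  · rw [tendsto_pi_nhds]
    intro i
    exact h5.tendsto_bestResponse hG (fun t => hz t i) hx hp
      (tendsto_comap.mono_left inf_le_right) ((hm i).mono_left inf_le_left) (hF p hp i)
  · intro t ht
    obtain ⟨h1, h2⟩ := hφ t ht
    exact ⟨h1, fun i => ⟨F (φ t) i, hF _ h1 i, hasDerivWithinAt_pi.1 h2 i⟩⟩

end LearningGame

end

/-! ### Assembly of the theorem. -/

theorem LearningGame.IsRun.tendsto_increment {ι Θ Ω : Type*} [Fintype ι] [DecidableEq ι] [Fintype Θ]
    [MeasurableSpace Ω] {P : Measure Ω} {d : ι → ℕ} {G : Game ι Θ d} {W : Matrix ι ι ℝ}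
    {α : ℕ → ℝ} {θs : Θ} {x : ℕ → Ω → Profile d} {y : ℕ → Ω → ι → ℝ}
    (h : IsRun P G W α θs x y) (hG : G.IsModel) (hα : IsStepSize α) (ω : Ω) :
    Tendsto (fun t => x (t + 1) ω - x t ω) atTop (𝓝 0) := by
  rw [tendsto_pi_nhds]
  intro i
  obtain ⟨C, hC⟩ := (hG.compact_strat i).isBounded.exists_norm_le
  refine squeeze_zero_norm (fun t => ?_) (by simpa using hα.tendsto_zero.mul_const (C + C))
  obtain ⟨z, hz, hx⟩ := h.strategy_update ω t i
  have h1 : x (t + 1) ω i - x t ω i = α t • (z - x t ω i) := by rw [hx]; module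
  rw [Pi.sub_apply, h1, norm_smul, Real.norm_of_nonneg (hα.mem_Ioo t).1.le]
  have h2 := hC _ hz.1
  have h3 := hC _ (h.mem_profiles hG hα t ω i)
  exact mul_le_mul_of_nonneg_left ((norm_sub_le _ _).trans (add_le_add h2 h3))
    (hα.mem_Ioo t).1.le

theorem theorem3 {ι Θ Ω : Type*} [Fintype ι] [DecidableEq ι] [Nonempty ι]
    [Fintype Θ] [DecidableEq Θ] [MeasurableSpace Ω]
    (P : Measure Ω) [IsProbabilityMeasure P] {d : ι → ℕ}
    (G : Game ι Θ d) (θs : Θ) (E : ι → ι → Prop) (W : Matrix ι ι ℝ) (α : ℕ → ℝ)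
    (x : ℕ → Ω → Profile d) (y : ℕ → Ω → ι → ℝ) (μ : ℕ → Ω → ι → Θ → ℝ)
    (hG : G.IsModel)
    (h1 : G.BoundedInformation)
    (h2 : G.Identifiable θs)
    (h3 : IsNetwork E W)
    (h4 : IsStepSize α)
    (h5 : G.ConvexCosts)
    (hrun : IsRun P G W α θs x y)
    (hμ : ∀ t ω, μ t ω = belief G W α (fun s => x s ω) (fun s => y s ω) t)
    (h6 : ∀ᵐ ω ∂P, ∀ m : Θ → ℝ,
      (∀ i θ, Tendsto (fun t => μ t ω i θ) atTop (𝓝 (m θ))) → G.BRConverges m) :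
    ∀ᵐ ω ∂P, ∃ m ∈ stdSimplex ℝ Θ, ∃ xs : Profile d,
      -- `m` is the common limit of the beliefs
      (∀ i θ, Tendsto (fun t => μ t ω i θ) atTop (𝓝 (m θ))) ∧
      -- `xs` is the Nash equilibrium of the game with the common belief `m`
      (∀ x', G.IsNash m x' ↔ x' = xs) ∧
      (∀ θ, G.networkDivergence xs θs θ ≠ ⊤) ∧
      (∀ i θ, Tendsto
        (fun T : ℕ => 1 / (∑ t ∈ Finset.Icc 1 T, α t) *
          Real.log (μ (T + 1) ω i θs / μ (T + 1) ω i θ))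
        atTop (𝓝 (G.networkDivergence xs θs θ).toReal)) ∧
      (∀ θ, θ ≠ θs → 0 < (G.networkDivergence xs θs θ).toReal) ∧
      (∀ i, Tendsto (fun t => μ t ω i θs) atTop (𝓝 1)) ∧
      (∀ ε : ℝ, 0 < ε → ∃ T' : ℕ, ∀ T ≥ T', ∀ i,
        1 / (1 + ∑ θ ∈ Finset.univ.erase θs,
          Real.exp (-(∑ t ∈ Finset.Icc 1 T, α t) *
            ((G.networkDivergence xs θs θ).toReal - ε))) ≤ μ (T + 1) ω i θs ∧
        μ (T + 1) ω i θs ≤ 1) := by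
  have : Nonempty Θ := ⟨θs⟩
  have hα0 := fun t => (h4.mem_Ioo t).1
  have hmem := hrun.mem_profiles hG h4
  have hclock : Tendsto (clock α) atTop atTop := h4.sum_eq_top
  -- The stated normalisation omits the step `α 0`, which the recursion includes.
  have hIcc : ∀ T, ∑ t ∈ Finset.Icc 1 T, α t = clock α (T + 1) - α 0 := by
    intro T
    rw [clock, Finset.sum_range_eq_add_Ico _ (Nat.succ_pos T), add_sub_cancel_left]
    rfl
  filter_upwards [hrun.ae_likelihood_pos hG h4 h1, ae_all_iff.2 fun θ =>
    hrun.ae_bounded_noise hG h4 h1 h3.doublyStochastic θ, h6] with ω hf hnoise hBR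
  simp only [hμ] at hBR ⊢
  set X : ℕ → Profile d := fun s => x s ω with hX
  set Y : ℕ → ι → ℝ := fun s => y s ω with hY
  set b := belief G W α X Y with hb
  have hXmem : ∀ t, X t ∈ G.profiles := fun t => hmem t ω
  have hne : G.profiles.Nonempty := ⟨_, hXmem 0⟩
  have hdx := hrun.tendsto_increment hG h4 ω
  have hodds : ∀ θ i, Tendsto (fun T => Real.log (b T i θs / b T i θ) / clock α T -
      clock (fun t => α t * average fun j => G.info θs θ j (X t)) T / clock α T)
      atTop (𝓝 0) := by
    intro θ i
    obtain ⟨B, hB⟩ := hnoise θ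
    exact h3.tendsto_logOdds_sub h4 hG h1 hXmem hdx hf hB i
  -- The drift is at least `c` per unit of elapsed time; half of it absorbs the o(elapsed time)
  -- error.
  have hdiv : ∀ θ, θ ≠ θs → ∀ i,
      Tendsto (fun T => Real.log (b T i θs / b T i θ)) atTop atTop := by
    intro θ hθ i
    obtain ⟨c, hc, hcle⟩ := h2.exists_average_info_ge hG h1 hθ hne
    refine tendsto_atTop_mono' atTop ?_ (hclock.const_mul_atTop (half_pos hc))
    filter_upwards [(hodds θ i).eventually (lt_mem_nhds (show -(c / 2) < 0 by linarith)),
      hclock.eventually_gt_atTop 0] with T hT hT0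
    rw [← sub_div, lt_div_iff₀ hT0] at hT
    have h7 : c * clock α T ≤ clock (fun t => α t * average fun j => G.info θs θ j (X t)) T := by
      rw [clock, clock, Finset.mul_sum]
      refine Finset.sum_le_sum fun t _ => ?_
      rw [mul_comm]
      exact mul_le_mul_of_nonneg_left (hcle _ (hXmem t)) (hα0 t).le
    linarith
  have hbelief : ∀ i, Tendsto (fun t => b t i) atTop (𝓝 (Pi.single θs 1)) := fun i =>
    tendsto_belief_single fun θ hθ => hdiv θ hθ i
  have hbelief' : ∀ i θ, Tendsto (fun t => b t i θ) atTop (𝓝 ((Pi.single θs 1 : Θ → ℝ) θ)) :=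
    fun i θ => tendsto_pi_nhds.1 (hbelief i) θ
  -- The common limit of the beliefs is now known to be the point mass, so the attraction hypothesis
  -- applies to it.
  obtain ⟨xs, hnash, hsol⟩ := (hBR _ hbelief').exists_unique
  have hxs : xs ∈ G.profiles := ((hnash xs).2 rfl).1
  have hZ : ∀ θ, (G.networkDivergence xs θs θ).toReal = average fun j => G.info θs θ j xs := by
    intro θ
    rw [h1.networkDivergence_eq hG hxs, ENNReal.toReal_ofReal]
    exact div_nonneg (Finset.sum_nonneg fun j _ => (h1.klDiv_eq hG hxs).1) (Nat.cast_nonneg _)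
  have hrate : ∀ i θ, Tendsto (fun T : ℕ => 1 / (∑ t ∈ Finset.Icc 1 T, α t) *
      Real.log (b (T + 1) i θs / b (T + 1) i θ)) atTop
      (𝓝 (G.networkDivergence xs θs θ).toReal) := by
    intro i θ
    have hc : ContinuousOn (fun p => average fun j => G.info θs θ j p) G.profiles :=
      (continuousOn_finsetSum _ fun j _ => hG.continuousOn_info h1).div_const _
    -- The index is shifted because the strategy update of period `t` uses the beliefs of period `t
    -- + 1`.
    have h7 := h5.tendsto_time_average hG h4 hXmem (m := fun t => b (t + 1))
      (fun i => (hbelief i).comp (tendsto_add_atTop_nat 1)) (hrun.strategy_update ω) hxs hsol hc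
    have h8 := ((hodds θ i).add h7).comp (tendsto_add_atTop_nat 1)
    have hclock1 := hclock.comp (tendsto_add_atTop_nat 1)
    -- Dividing by this factor replaces `clock α (T + 1)` by the stated sum from 1 to `T`.
    have h9 : Tendsto (fun T => 1 - α 0 / clock α (T + 1)) atTop (𝓝 1) := by
      simpa using (hclock1.const_div_atTop (α 0)).const_sub 1
    have h10 := h8.div h9 one_ne_zero
    rw [hZ, zero_add, div_one] at *
    refine h10.congr' ?_
    filter_upwards [hclock1.eventually_gt_atTop (α 0)] with T hT
    have hT1 : α 0 < clock α (T + 1) := hT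
    have hT2 : clock α (T + 1) ≠ 0 := ((hα0 0).trans hT1).ne'
    have hT3 : clock α (T + 1) - α 0 ≠ 0 := (sub_pos.2 hT1).ne'
    simp only [hIcc, Function.comp_apply, Pi.div_apply]
    rw [sub_add_cancel]
    field_simp
  refine ⟨Pi.single θs 1, single_mem_stdSimplex ℝ θs, xs, hbelief', hnash, fun θ => ?_, hrate,
    fun θ hθ => ?_, fun i => ?_, fun ε hε => ?_⟩
  · rw [h1.networkDivergence_eq hG hxs]
    exact ENNReal.ofReal_ne_top
  · obtain ⟨c, hc, hcle⟩ := h2.exists_average_info_ge hG h1 hθ hne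
    rw [hZ]
    exact hc.trans_le (hcle _ hxs)
  · simpa using hbelief' i θs
  · have hev : ∀ᶠ T : ℕ in atTop, ∀ i θ, (G.networkDivergence xs θs θ).toReal - ε <
        1 / (∑ t ∈ Finset.Icc 1 T, α t) * Real.log (b (T + 1) i θs / b (T + 1) i θ) :=
      eventually_all.2 fun i => eventually_all.2 fun θ =>
        (hrate i θ).eventually (lt_mem_nhds (by linarith))
    have hev' : ∀ᶠ T : ℕ in atTop, 0 < ∑ t ∈ Finset.Icc 1 T, α t := by
      filter_upwards [(hclock.comp (tendsto_add_atTop_nat 1)).eventually_gt_atTop (α 0)] with T hT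
      rw [hIcc]
      exact sub_pos.2 hT
    obtain ⟨T', hT'⟩ := eventually_atTop.1 (hev.and hev')
    refine ⟨T', fun T hT i => ⟨?_, ?_⟩⟩
    · obtain ⟨h7, h8⟩ := hT' T hT
      rw [hb, belief_eq_one_div (T + 1) i θs, ← hb]
      refine one_div_le_one_div_of_le
        (add_pos_of_pos_of_nonneg one_pos (Finset.sum_nonneg fun θ _ => (Real.exp_pos _).le)) ?_
      gcongr with θ hθ
      have h9 := h7 i θ
      rw [one_div_mul_eq_div, lt_div_iff₀ h8] at h9
      linarith
    · rw [← sum_belief (G := G) (W := W) (α := α) (x := X) (y := Y) (T + 1) i]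
      exact Finset.single_le_sum (f := b (T + 1) i) (fun θ _ => (belief_pos _ _ _).le)
        (Finset.mem_univ θs)
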